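/- Let $K$ be a field of characteristic zero and $\mathcal D$ a nonempty set with an associative and commutative product $(a,b)\mapsto[ab]$, extended bilinearly to the vector space $K(\mathcal D)$ with basis $\mathcal D$. *The two Hopf algebras.* Let $H_{CK}^{\mathcal D}$ be the Connes–Kreimer Hopf algebra. Its basis is the set of (isomorphism classes of) finite rooted forests $F$ with vertices decorated by $\mathcal D$, its product is the concatenation of forests, and its coproduct is $\Delta(F)=\sum_{\boldsymbol v} Lea_{\boldsymbol v}(F)\otimes Roo_{\boldsymbol v}(F)$. Here edges are oriented towards the roots, $a\twoheadrightarrow b$ means that there is an oriented path (possibly of length zero) from $a$ to $b$, the sum runs over the sets $\boldsymbol v$ of vertices of $F$ that are pairwise incomparable for $\twoheadrightarrow$, $Lea_{\boldsymbol v}(F)$ is the forest induced on the vertices $w$ with $w\twoheadrightarrow v$ for some $v\in\boldsymbol v$, and $Roo_{\boldsymbol v}(F)$ is the forest induced on the other vertices. Let $Csh^{\mathcal D}$ be the quasi-shuffle Hopf algebra. Its basis is the set of words with letters in $\mathcal D$, its coproduct is deconcatenation, and its product is the quasi-shuffle product, for which the empty word is the unit and $au * bv = a(u*bv)+b(au*v)+[ab](u*v)$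 for letters $a,b$ and words $u,v$. Let $\pi:Csh^{\mathcal D}\to K(\mathcal D)$ be the projection that fixes the words of length one and kills all the other words. *Contractions and linear preorders.* Let $T$ be a nonempty rooted tree with vertices decorated by $\mathcal D$. For a set $\boldsymbol e$ of edges of $T$, let $Part_{\boldsymbol e}(T)$ be the decorated forest obtained by keeping all the vertices of $T$ and only the edges in $\boldsymbol e$, and let $Cont_{\boldsymbol e}(T)$ be the rooted tree obtained from $T$ by contracting the edges in $\boldsymbol e$; its vertices are the connected components of $Part_{\boldsymbol e}(T)$. Let $\mathcal O_p(Cont_{\boldsymbol e}(T))$ be the set of all surjections $\sigma: V(Cont_{\boldsymbol e}(T))\to\{1,\dots,q\}$, with $q\geq 1$ arbitrary, such that $\sigma(a)>\sigma(b)$ whenever $a\ne b$ and $a\twoheadrightarrow b$. *Statement.* Let $\varphi$ be a $K$-linear map from the vector space spanned by the (isomorphism classes of) nonempty rooted trees decorated by $\mathcal D$ to $K(\mathcal D)$. There is a unique Hopf algebra morphism $\Phi:H_{CK}^{\mathcal D}\to Csh^{\mathcal D}$ such that $\pi(\Phi(T))=\varphi(T)$ for every nonempty decorated rooted tree $T$,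 and for every such $T$ $$\Phi(T)=\sum_{\boldsymbol e\subseteq E(T)}\ \sum_{\substack{\sigma\in\mathcal O_p(Cont_{\boldsymbol e}(T))\\ Im(\sigma)=\{1,\dots,q\}}}\varphi(\sigma^{-1}(q))\cdots\varphi(\sigma^{-1}(1)).$$ Here, if $T_1,\dots,T_n$ are the connected components of $Part_{\boldsymbol e}(T)$ that $\sigma$ maps to $i$, then $\varphi(\sigma^{-1}(i))=[\varphi(T_1)\cdots\varphi(T_n)]\in K(\mathcal D)$ is their bracket-product (equal to $\varphi(T_1)$ if $n=1$), and the word $\varphi(\sigma^{-1}(q))\cdots\varphi(\sigma^{-1}(1))$ with letters in $K(\mathcal D)$ is expanded multilinearly in $Csh^{\mathcal D}$. -/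

import Mathlib

open scoped TensorProduct

noncomputable section

/-! ### Rooted forests -/

/-- A finite rooted forest: every vertex has at most one parent (the roots have none), and the
edges, which run from a vertex to its parent, form no oriented cycle. Its connected components are
rooted trees. -/
structure RootedForest where
  V : Type
  [fintypeV : Fintype V]
  parent : V → Option V
  acyclic : ∀ v, ¬ Relation.TransGen (fun a b => parent a = some b) v v

namespace RootedForest

attribute [instance] RootedForest.fintypeV

variable (F : RootedForest)

/-- `a → b`: there is an edge from `a` down to `b`. -/
def Step (a b : F.V) : Prop := F.parent a = some b

/-- `a ↠ b`: there is an oriented path (possibly of length zero) from `a` down to `b`. -/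
def Reach (a b : F.V) : Prop := Relation.ReflTransGen F.Step a b

/-- A rooted tree is a (nonempty) rooted forest with exactly one root. -/
def IsTree : Prop := ∃! r, F.parent r = none

open Classical in
/-- The set of edges. Each non-root vertex is the upper end of exactly one edge, and the edge is
named by that vertex. -/
def edges : Finset F.V := Finset.univ.filter fun v => F.parent v ≠ none

/-- Admissible cuts: sets of vertices that are pairwise incomparable for `↠`. -/
def IsCut (c : Finset F.V) : Prop := ∀ a ∈ c, ∀ b ∈ c, a ≠ b → ¬ F.Reach a b

/-- `w` lies above the cut `c`. -/
def Above (c : Finset F.V) (w : F.V) : Prop := ∃ v ∈ c, F.Reach w v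

open Classical in
/-- The forest on the vertices satisfying `p`, with all the edges of `F` between them. -/
abbrev induce (p : F.V → Prop) : RootedForest where
  V := {v // p v}
  parent v := (F.parent v).bind fun u => if h : p u then some ⟨u, h⟩ else none
  acyclic v h := by
    refine F.acyclic v.1 (Relation.TransGen.lift Subtype.val ?_ _ _ h)
    rintro ⟨a, ha⟩ ⟨b, hb⟩ hab
    simp only [Option.bind_eq_some_iff] at hab
    obtain ⟨u, hu, h'⟩ := hab
    split_ifs at h' with hp
    simp only [Option.some.injEq, Subtype.mk.injEq] at h'
    simpa [← h'] using hu

open Classical in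
/-- `Part_e(F)`: keep all the vertices, and only the edges in `e`. -/
abbrev part (e : Finset F.V) : RootedForest where
  V := F.V
  parent v := if v ∈ e then F.parent v else none
  acyclic v h := by
    refine F.acyclic v (Relation.TransGen.mono (fun a b hab => ?_) _ _ h)
    split_ifs at hab
    exact hab

theorem exists_root (v : F.V) : ∃ r, F.Reach v r ∧ F.parent r = none := by
  let R : F.V → F.V → Prop := fun b a => Relation.TransGen F.Step a b
  have : IsTrans F.V R := ⟨fun _ _ _ h1 h2 => Relation.TransGen.trans h2 h1⟩
  have : Std.Irrefl R := ⟨fun a h => F.acyclic a h⟩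
  have wf : WellFounded R := Finite.wellFounded_of_trans_of_irrefl R
  induction v using wf.induction with
  | _ v ih =>
    rcases hv : F.parent v with _ | u
    · exact ⟨v, Relation.ReflTransGen.refl, hv⟩
    · obtain ⟨r, hr, hr'⟩ := ih u (Relation.TransGen.single hv)
      exact ⟨r, Relation.ReflTransGen.head hv hr, hr'⟩

theorem root_unique {v r s : F.V} (hr : F.Reach v r) (hr' : F.parent r = none)
    (hs : F.Reach v s) (hs' : F.parent s = none) : r = s := by
  induction hr using Relation.ReflTransGen.head_induction_on with
  | refl =>
    rcases Relation.ReflTransGen.cases_head hs with h | ⟨u, hu, _⟩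
    · exact h
    · simp [Step, hr'] at hu
  | head h _ ih =>
    rcases Relation.ReflTransGen.cases_head hs with h' | ⟨u, hu, hus⟩
    · subst h'
      simp [Step, hs'] at h
    · have : u = _ := Option.some.inj (hu.symm.trans h)
      subst this
      exact ih hus

/-- The root of the connected component of `v`. -/
def rootOf (v : F.V) : F.V := (F.exists_root v).choose

theorem reach_rootOf (v : F.V) : F.Reach v (F.rootOf v) := (F.exists_root v).choose_spec.1

theorem parent_rootOf (v : F.V) : F.parent (F.rootOf v) = none :=
  (F.exists_root v).choose_spec.2

theorem reach_of_part {e : Finset F.V} {a b : F.V} (h : (F.part e).Reach a b) : F.Reach a b := by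
  refine Relation.ReflTransGen.mono (fun x y (hxy : (F.part e).parent x = some y) => ?_) _ _ h
  simp only [part] at hxy
  split_ifs at hxy
  exact hxy

/-- The connected components of a rooted forest, each one named by its root. -/
abbrev Component : Type := {r : F.V // F.parent r = none}

open Classical in
/-- `Cont_e(F)`: contract every edge in `e`. The vertices are the connected components of
`Part_e(F)`; the edge of `F` from the root `r` of a component to a vertex `u` becomes an edge from
the component of `r` to the component of `u`. -/
abbrev cont (e : Finset F.V) : RootedForest where
  V := (F.part e).Component
  parent r := (F.parent r.1).map fun u => ⟨(F.part e).rootOf u, (F.part e).parent_rootOf u⟩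
  acyclic v h := by
    have key : ∀ a b : (F.part e).Component,
        Relation.TransGen (fun a b : (F.part e).Component =>
          (F.parent a.1).map (fun u => (⟨(F.part e).rootOf u, (F.part e).parent_rootOf u⟩ :
            (F.part e).Component)) = some b) a b →
        Relation.TransGen F.Step a.1 b.1 := by
      have one : ∀ a b : (F.part e).Component,
          (F.parent a.1).map (fun u => (⟨(F.part e).rootOf u, (F.part e).parent_rootOf u⟩ :
            (F.part e).Component)) = some b → Relation.TransGen F.Step a.1 b.1 := by
        intro a b hab
        rw [Option.map_eq_some_iff] at hab
        obtain ⟨u, hu, rfl⟩ := hab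
        exact Relation.TransGen.head' hu (F.reach_of_part ((F.part e).reach_rootOf u))
      intro a b hab
      induction hab with
      | single h => exact one _ _ h
      | tail _ h ih => exact ih.trans (one _ _ h)
    exact F.acyclic v.1 (key v v h)

/-- A linear preorder: a surjection `σ : V(F) → {1, …, q}` (here `{0, …, q - 1}`) with
`σ(a) > σ(b)` whenever `a ≠ b` and `a ↠ b`. -/
def IsLinearPreorder {q : ℕ} (σ : F.V → Fin q) : Prop :=
  Function.Surjective σ ∧ ∀ a b, a ≠ b → F.Reach a b → σ b < σ a

open Classical in
/-- The linear preorders on `F` with image of size `q`. -/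
def linearPreorders (q : ℕ) : Finset (F.V → Fin q) :=
  Finset.univ.filter fun σ => F.IsLinearPreorder σ

/-- The disjoint union of two rooted forests. -/
abbrev union (F G : RootedForest) : RootedForest where
  V := F.V ⊕ G.V
  parent := Sum.elim (fun v => (F.parent v).map Sum.inl) (fun v => (G.parent v).map Sum.inr)
  acyclic := by
    have hl : ∀ x y : F.V ⊕ G.V, Relation.TransGen (fun a b =>
        Sum.elim (fun v => (F.parent v).map (Sum.inl : F.V → F.V ⊕ G.V))
          (fun v => (G.parent v).map Sum.inr) a = some b) x y →
        (∃ a b, x = Sum.inl a ∧ y = Sum.inl b ∧ Relation.TransGen F.Step a b) ∨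
        (∃ a b, x = Sum.inr a ∧ y = Sum.inr b ∧ Relation.TransGen G.Step a b) := by
      have one : ∀ x y : F.V ⊕ G.V,
          Sum.elim (fun v => (F.parent v).map (Sum.inl : F.V → F.V ⊕ G.V))
          (fun v => (G.parent v).map Sum.inr) x = some y →
          (∃ a b, x = Sum.inl a ∧ y = Sum.inl b ∧ F.Step a b) ∨
          (∃ a b, x = Sum.inr a ∧ y = Sum.inr b ∧ G.Step a b) := by
        rintro (a | a) y h
        · obtain ⟨b, hb, rfl⟩ := Option.map_eq_some_iff.1 h
          exact Or.inl ⟨a, b, rfl, rfl, hb⟩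
        · obtain ⟨b, hb, rfl⟩ := Option.map_eq_some_iff.1 h
          exact Or.inr ⟨a, b, rfl, rfl, hb⟩
      intro x y h
      induction h with
      | single h' =>
        rcases one _ _ h' with ⟨a, b, rfl, rfl, h⟩ | ⟨a, b, rfl, rfl, h⟩
        · exact Or.inl ⟨a, b, rfl, rfl, Relation.TransGen.single h⟩
        · exact Or.inr ⟨a, b, rfl, rfl, Relation.TransGen.single h⟩
      | tail _ h ih =>
        rcases ih with ⟨a, b, rfl, rfl, h1⟩ | ⟨a, b, rfl, rfl, h1⟩ <;>
        rcases one _ _ h with ⟨a', b', h2, rfl, h3⟩ | ⟨a', b', h2, rfl, h3⟩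
        · cases h2; exact Or.inl ⟨a, b', rfl, rfl, h1.tail h3⟩
        · cases h2
        · cases h2
        · cases h2; exact Or.inr ⟨a, b', rfl, rfl, h1.tail h3⟩
    intro v h
    rcases hl v v h with ⟨a, b, h1, h2, h3⟩ | ⟨a, b, h1, h2, h3⟩
    · cases h1; cases h2; exact F.acyclic _ h3
    · cases h1; cases h2; exact G.acyclic _ h3

/-- The empty forest. -/
abbrev empty : RootedForest where
  V := Empty
  parent := Empty.elim
  acyclic v := v.elim

end RootedForest

/-! ### Decorated forests and their isomorphism classes -/

universe u v

/-- A rooted forest with its vertices decorated by `D`. -/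
structure DecForest (D : Type u) extends RootedForest where
  dec : V → D

namespace DecForest

variable {D : Type u}

/-- An isomorphism of decorated rooted forests. -/
structure Iso (F G : DecForest D) where
  toEquiv : F.V ≃ G.V
  parent_map : ∀ x, G.parent (toEquiv x) = (F.parent x).map toEquiv
  dec_map : ∀ x, G.dec (toEquiv x) = F.dec x

namespace Iso

variable {F G H : DecForest D}

def refl (F : DecForest D) : Iso F F := ⟨Equiv.refl _, fun x => by simp, fun _ => rfl⟩

def symm (f : Iso F G) : Iso G F where
  toEquiv := f.toEquiv.symm
  parent_map x := by
    obtain ⟨y, rfl⟩ := f.toEquiv.surjective x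
    rw [f.parent_map]
    simp [Option.map_map, Function.comp_def]
  dec_map x := by
    obtain ⟨y, rfl⟩ := f.toEquiv.surjective x
    simp [f.dec_map]

def trans (f : Iso F G) (g : Iso G H) : Iso F H where
  toEquiv := f.toEquiv.trans g.toEquiv
  parent_map x := by
    simp [f.parent_map, g.parent_map, Option.map_map, Function.comp_def]
  dec_map x := by simp [f.dec_map, g.dec_map]

theorem step_iff (f : Iso F G) (a b : F.V) :
    G.Step (f.toEquiv a) (f.toEquiv b) ↔ F.Step a b := by
  simp [RootedForest.Step, f.parent_map]

theorem reach_of (f : Iso F G) {a b : F.V} (h : F.Reach a b) :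
    G.Reach (f.toEquiv a) (f.toEquiv b) :=
  Relation.ReflTransGen.lift f.toEquiv (fun a b h => (f.step_iff a b).2 h) _ _ h

theorem reach_iff (f : Iso F G) (a b : F.V) :
    G.Reach (f.toEquiv a) (f.toEquiv b) ↔ F.Reach a b := by
  refine ⟨fun h => ?_, f.reach_of⟩
  have := f.symm.reach_of h
  simpa [symm] using this

theorem isTree_of (f : Iso F G) (h : F.IsTree) : G.IsTree := by
  obtain ⟨r, hr, huniq⟩ := h
  refine ⟨f.toEquiv r, by simp [f.parent_map, hr], fun s hs => ?_⟩
  obtain ⟨t, rfl⟩ := f.toEquiv.surjective s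
  have : F.parent t = none := by simpa [f.parent_map] using hs
  rw [huniq t this]

end Iso

/-- Isomorphism of decorated rooted forests, as an equivalence relation. -/
instance isoSetoid (D : Type u) : Setoid (DecForest D) where
  r F G := Nonempty (Iso F G)
  iseqv :=
    ⟨fun F => ⟨Iso.refl F⟩, fun ⟨f⟩ => ⟨f.symm⟩, fun ⟨f⟩ ⟨g⟩ => ⟨f.trans g⟩⟩

/-- The decorated forest induced on the vertices satisfying `p`. -/
abbrev induce (F : DecForest D) (p : F.V → Prop) : DecForest D where
  toRootedForest := F.toRootedForest.induce p
  dec v := F.dec v.1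

/-- `Part_e(F)` with the decorations of `F`. -/
abbrev part (F : DecForest D) (e : Finset F.V) : DecForest D where
  toRootedForest := F.toRootedForest.part e
  dec := F.dec

/-- `Lea_c(F)`: the part of `F` above the cut `c`. -/
abbrev lea (F : DecForest D) (c : Finset F.V) : DecForest D := F.induce fun w => F.Above c w

/-- `Roo_c(F)`: the part of `F` that is not above the cut `c`. -/
abbrev roo (F : DecForest D) (c : Finset F.V) : DecForest D := F.induce fun w => ¬ F.Above c w

/-- The connected component with root `r`: all the vertices from which `r` is reached. -/
abbrev component (F : DecForest D) (r : F.Component) : DecForest D :=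
  F.induce fun w => F.Reach w r.1

theorem component_isTree (F : DecForest D) (r : F.Component) : (F.component r).IsTree := by
  refine ⟨⟨r.1, Relation.ReflTransGen.refl⟩, ?_, ?_⟩
  · change (F.parent r.1).bind _ = none
    rw [r.2]; rfl
  · rintro ⟨w, hw⟩ h
    change (F.parent w).bind _ = none at h
    apply Subtype.ext
    change w = r.1
    rcases Relation.ReflTransGen.cases_head hw with h' | ⟨u, hu, hur⟩
    · exact h'
    · exfalso
      have hu' : F.parent w = some u := hu
      have hur' : F.Reach u r.1 := hur
      simp [hu', hur'] at h

/-- The disjoint union of two decorated forests. -/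
abbrev union (F G : DecForest D) : DecForest D where
  toRootedForest := F.toRootedForest.union G.toRootedForest
  dec := Sum.elim F.dec G.dec

/-- The empty decorated forest. -/
abbrev empty (D : Type u) : DecForest D where
  toRootedForest := RootedForest.empty
  dec := Empty.elim

/-- Isomorphic forests have isomorphic induced subforests on corresponding vertices. -/
def Iso.induce {F G : DecForest D} (f : Iso F G) {p : F.V → Prop} {p' : G.V → Prop}
    (h : ∀ x, p x ↔ p' (f.toEquiv x)) : Iso (F.induce p) (G.induce p') where
  toEquiv := f.toEquiv.subtypeEquiv h
  parent_map := by
    rintro ⟨x, hx⟩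
    change (G.parent (f.toEquiv x)).bind _ = ((F.parent x).bind _).map _
    rw [f.parent_map]
    rcases F.parent x with _ | y
    · rfl
    · by_cases hy : p y
      · have hy' := (h y).1 hy
        simp only [Option.map_some, Option.bind_some, hy, hy', dite_true]
        rfl
      · have hy' : ¬ p' (f.toEquiv y) := fun h' => hy ((h y).2 h')
        simp only [Option.map_some, Option.bind_some, hy, hy', dite_false]
        rfl
  dec_map x := f.dec_map x.1

/-- Disjoint union respects isomorphisms. -/
def Iso.union {F G F' G' : DecForest D} (f : Iso F F') (g : Iso G G') :
    Iso (F.union G) (F'.union G') where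
  toEquiv := Equiv.sumCongr f.toEquiv g.toEquiv
  parent_map := by
    rintro (x | x)
    · change (F'.parent (f.toEquiv x)).map _ = ((F.parent x).map _).map _
      rw [f.parent_map]; cases F.parent x <;> rfl
    · change (G'.parent (g.toEquiv x)).map _ = ((G.parent x).map _).map _
      rw [g.parent_map]; cases G.parent x <;> rfl
  dec_map := by
    rintro (x | x)
    · exact f.dec_map x
    · exact g.dec_map x

end DecForest

/-- Rooted forests decorated by `D` (isomorphism classes). -/
def ForestClass (D : Type u) : Type (max 1 u) := Quotient (DecForest.isoSetoid D)

namespace ForestClass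

variable {D : Type u}

/-- The class of a decorated forest. -/
def mk (F : DecForest D) : ForestClass D := Quotient.mk _ F

/-- Being a tree, for classes. -/
def IsTree : ForestClass D → Prop :=
  Quotient.lift (fun F : DecForest D => F.IsTree) fun _ _ ⟨f⟩ =>
    propext ⟨f.isTree_of, f.symm.isTree_of⟩

/-- Concatenation of forests is a commutative monoid law whose unit is the empty forest. -/
instance : CommMonoid (ForestClass D) where
  mul := Quotient.map₂ DecForest.union fun _ _ ⟨f⟩ _ _ ⟨g⟩ => ⟨f.union g⟩
  one := mk (DecForest.empty D)
  mul_assoc := by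
    rintro ⟨F⟩ ⟨G⟩ ⟨H⟩
    refine Quotient.sound ⟨⟨Equiv.sumAssoc _ _ _, ?_, ?_⟩⟩
    · rintro ((x | x) | x)
      · change (F.parent x).map _ = (((F.parent x).map _).map _).map _
        cases F.parent x <;> rfl
      · change ((G.parent x).map _).map _ = (((G.parent x).map _).map _).map _
        cases G.parent x <;> rfl
      · change ((H.parent x).map _).map _ = ((H.parent x).map _).map _
        cases H.parent x <;> rfl
    · rintro ((x | x) | x) <;> rfl
  one_mul := by
    rintro ⟨F⟩
    refine Quotient.sound ⟨⟨Equiv.emptySum Empty _, ?_, ?_⟩⟩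
    · rintro (x | x)
      · exact x.elim
      · change F.parent x = ((F.parent x).map _).map _
        cases F.parent x <;> rfl
    · rintro (x | x)
      · exact x.elim
      · rfl
  mul_one := by
    rintro ⟨F⟩
    refine Quotient.sound ⟨⟨Equiv.sumEmpty _ Empty, ?_, ?_⟩⟩
    · rintro (x | x)
      · change F.parent x = ((F.parent x).map _).map _
        cases F.parent x <;> rfl
      · exact x.elim
    · rintro (x | x)
      · rfl
      · exact x.elim
  mul_comm := by
    rintro ⟨F⟩ ⟨G⟩
    refine Quotient.sound ⟨⟨Equiv.sumComm _ _, ?_, ?_⟩⟩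
    · rintro (x | x)
      · change (F.parent x).map _ = ((F.parent x).map _).map _
        cases F.parent x <;> rfl
      · change (G.parent x).map _ = ((G.parent x).map _).map _
        cases G.parent x <;> rfl
    · rintro (x | x) <;> rfl

end ForestClass

/-- Nonempty rooted trees decorated by `D` (isomorphism classes). -/
def TreeClass (D : Type u) : Type (max 1 u) := {t : ForestClass D // t.IsTree}

/-- The class of a decorated tree. -/
def TreeClass.mk {D : Type u} (T : DecForest D) (hT : T.IsTree) : TreeClass D :=
  ⟨ForestClass.mk T, hT⟩

/-! ### The Connes–Kreimer Hopf algebra -/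

/-- `H_CK^D`: the vector space with basis the decorated rooted forests; the product is induced by
the concatenation of forests. -/
def HCK (K : Type v) [Field K] (D : Type u) : Type (max 1 u v) := MonoidAlgebra K (ForestClass D)

namespace HCK

variable (K : Type v) [Field K] {D : Type u}

instance : CommRing (HCK K D) := inferInstanceAs (CommRing (MonoidAlgebra K (ForestClass D)))

instance : Algebra K (HCK K D) := inferInstanceAs (Algebra K (MonoidAlgebra K (ForestClass D)))

/-- The basis vector of a forest. -/
def of (c : ForestClass D) : HCK K D := MonoidAlgebra.single c 1

/-- The linear map with prescribed values on the basis of forests. -/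
def linearLift {M : Type*} [AddCommMonoid M] [Module K M] (f : ForestClass D → M) :
    HCK K D →ₗ[K] M :=
  Finsupp.linearCombination K f ∘ₗ
    (MonoidAlgebra.coeffLinearEquiv K : MonoidAlgebra K (ForestClass D) ≃ₗ[K] _).toLinearMap

open Classical in
/-- The cut coproduct of a forest, `∑ Lea_c(F) ⊗ Roo_c(F)` over the admissible cuts `c`. -/
def cutSum (F : DecForest D) : HCK K D ⊗[K] HCK K D :=
  ∑ c ∈ Finset.univ.filter (fun c : Finset F.V => F.IsCut c),
    of K (ForestClass.mk (F.lea c)) ⊗ₜ[K] of K (ForestClass.mk (F.roo c))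

theorem cutSum_congr {F G : DecForest D} (f : DecForest.Iso F G) : cutSum K F = cutSum K G := by
  classical
  have hmem : ∀ (c : Finset F.V) (x : F.V),
      f.toEquiv x ∈ c.map f.toEquiv.toEmbedding ↔ x ∈ c := by
    intro c x; simp
  have habove : ∀ (c : Finset F.V) (w : F.V),
      F.Above c w ↔ G.Above (c.map f.toEquiv.toEmbedding) (f.toEquiv w) := by
    intro c w
    constructor
    · rintro ⟨v, hv, hwv⟩
      exact ⟨f.toEquiv v, (hmem c v).2 hv, f.reach_of hwv⟩
    · rintro ⟨v, hv, hwv⟩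
      obtain ⟨x, rfl⟩ := f.toEquiv.surjective v
      exact ⟨x, (hmem c x).1 hv, (f.reach_iff _ _).1 hwv⟩
  unfold cutSum
  refine Finset.sum_equiv (Equiv.finsetCongr f.toEquiv) ?_ ?_
  · intro c
    rw [Finset.mem_filter_univ, Finset.mem_filter_univ]
    simp only [RootedForest.IsCut, Equiv.finsetCongr_apply, Finset.forall_mem_map,
      Equiv.coe_toEmbedding, f.reach_iff, Ne, f.toEquiv.injective.eq_iff]
  · intro c _
    have h1 : ForestClass.mk (F.lea c) = ForestClass.mk (G.lea (Equiv.finsetCongr f.toEquiv c)) :=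
      Quotient.sound ⟨f.induce fun w => habove c w⟩
    have h2 : ForestClass.mk (F.roo c) = ForestClass.mk (G.roo (Equiv.finsetCongr f.toEquiv c)) :=
      Quotient.sound ⟨f.induce fun w => not_congr (habove c w)⟩
    rw [h1, h2]

open Classical in
/-- The coproduct is the cut coproduct; the counit is `1` on the empty forest and `0` on all the
other forests. -/
instance : CoalgebraStruct K (HCK K D) where
  comul := linearLift K (Quotient.lift (cutSum K) fun _ _ ⟨f⟩ => cutSum_congr K f)
  counit := linearLift K fun c => if c = 1 then 1 else 0

/-- The inclusion of the span of the trees. -/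
def ofTrees : (TreeClass D →₀ K) →ₗ[K] HCK K D :=
  Finsupp.linearCombination K fun t => of K t.1

end HCK

/-! ### The quasi-shuffle Hopf algebra -/

/-- `Csh^D`: the vector space with basis the words with letters in `D`. -/
def Csh (K : Type v) [Field K] (D : Type u) : Type (max u v) := List D →₀ K

namespace Csh

variable (K : Type v) [Field K] {D : Type u}

instance : AddCommGroup (Csh K D) := inferInstanceAs (AddCommGroup (List D →₀ K))

instance : Module K (Csh K D) := inferInstanceAs (Module K (List D →₀ K))

/-- The basis vector of a word. -/
def word (w : List D) : Csh K D := Finsupp.single w (1 : K)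

/-- The linear map with prescribed values on the basis of words. -/
def linearLift {M : Type*} [AddCommMonoid M] [Module K M] (f : List D → M) : Csh K D →ₗ[K] M :=
  Finsupp.linearCombination K f

@[simp] theorem linearLift_word {M : Type*} [AddCommMonoid M] [Module K M] (f : List D → M)
    (w : List D) : linearLift K f (word K w) = f w := by
  simp only [linearLift, word]
  exact (Finsupp.linearCombination_single K 1 w).trans (one_smul K _)

variable {K} in
theorem hom_ext {M : Type*} [AddCommMonoid M] [Module K M] {f g : Csh K D →ₗ[K] M}
    (h : ∀ w, f (word K w) = g (word K w)) : f = g :=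
  Finsupp.lhom_ext' fun w => LinearMap.ext_ring (h w)

/-- Put the letter `a` in front of words. -/
def cons (a : D) : Csh K D →ₗ[K] Csh K D := linearLift K fun w => word K (a :: w)

@[simp] theorem cons_word (a : D) (w : List D) : cons K a (word K w) = word K (a :: w) := by
  simp [cons]

variable [CommSemigroup D]

/-- The quasi-shuffle product of two words, where `a * b` is the bracket `[ab]` of letters:
`au ⧢ bv = a (u ⧢ bv) + b (au ⧢ v) + [ab] (u ⧢ v)`, and the empty word is the unit. -/
def qshWord : List D → List D → Csh K D
  | [], v => word K v
  | a :: u, [] => word K (a :: u)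
  | a :: u, b :: v =>
    cons K a (qshWord u (b :: v)) + cons K b (qshWord (a :: u) v) + cons K (a * b) (qshWord u v)
termination_by u v => u.length + v.length

/-- The quasi-shuffle product. -/
def qsh : Csh K D →ₗ[K] Csh K D →ₗ[K] Csh K D :=
  linearLift K fun u => linearLift K fun v => qshWord K u v

@[simp] theorem qsh_word (u v : List D) : qsh K (word K u) (word K v) = qshWord K u v := by
  simp [qsh]

theorem qsh_one_left (x : Csh K D) : qsh K (word K []) x = x := by
  have : qsh K (word K ([] : List D)) = LinearMap.id := hom_ext fun w => by simp [qshWord]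
  rw [this]; rfl

theorem qshWord_nil_right (u : List D) : qshWord K u [] = word K u := by
  cases u <;> simp [qshWord]

theorem qshWord_comm (u v : List D) : qshWord K u v = qshWord K v u := by
  induction u generalizing v with
  | nil => simp [qshWord, qshWord_nil_right]
  | cons a u ih =>
    induction v with
    | nil => simp [qshWord]
    | cons b v ih' =>
      rw [qshWord, qshWord, ih (b :: v), ih v, ih', mul_comm a b, add_comm (cons K a _)]

theorem qsh_comm (x y : Csh K D) : qsh K x y = qsh K y x := by
  have : qsh (D := D) K = (qsh K).flip :=
    hom_ext fun u => hom_ext fun v => by simp [qshWord_comm K u v]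
  exact congrFun (congrArg DFunLike.coe (congrFun (congrArg DFunLike.coe this) x)) y

theorem qsh_cons_cons (a b : D) (x y : Csh K D) :
    qsh K (cons K a x) (cons K b y) =
      cons K a (qsh K x (cons K b y)) + cons K b (qsh K (cons K a x) y) +
        cons K (a * b) (qsh K x y) := by
  have : (qsh K).compl₁₂ (cons K a) (cons K b) =
      ((qsh K).compl₁₂ LinearMap.id (cons K b)).compr₂ (cons K a) +
      ((qsh K).compl₁₂ (cons K a) LinearMap.id).compr₂ (cons K b) +
      (qsh K).compr₂ (cons K (a * b)) :=
    hom_ext fun u => hom_ext fun v => by simp [qshWord]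
  exact congrFun (congrArg DFunLike.coe (congrFun (congrArg DFunLike.coe this) x)) y

theorem qsh_assoc_word (u v w : List D) :
    qsh K (qsh K (word K u) (word K v)) (word K w) =
      qsh K (word K u) (qsh K (word K v) (word K w)) := by
  match u, v, w with
  | [], v, w => simp only [qsh_one_left]
  | u, [], w => rw [qsh_comm K _ (word K []), qsh_one_left, qsh_one_left]
  | u, v, [] => rw [qsh_comm K _ (word K []), qsh_one_left, qsh_comm K _ (word K []), qsh_one_left]
  | a :: u, b :: v, c :: w =>
    have h1 := qsh_assoc_word u (b :: v) (c :: w)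
    have h2 := qsh_assoc_word (a :: u) v (c :: w)
    have h3 := qsh_assoc_word (a :: u) (b :: v) w
    have h4 := qsh_assoc_word u v (c :: w)
    have h5 := qsh_assoc_word u (b :: v) w
    have h6 := qsh_assoc_word (a :: u) v w
    have h7 := qsh_assoc_word u v w
    simp only [← cons_word] at h1 h2 h3 h4 h5 h6 h7 ⊢
    generalize word K u = x at *
    generalize word K v = y at *
    generalize word K w = z at *
    have e1 := qsh_cons_cons K a b x y
    have e2 := qsh_cons_cons K b c y z
    rw [e2] at h1
    rw [e1] at h3
    rw [e1, e2]
    replace h1 := congrArg (cons K a) h1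
    replace h2 := congrArg (cons K b) h2
    replace h3 := congrArg (cons K c) h3
    replace h4 := congrArg (cons K (a * b)) h4
    replace h5 := congrArg (cons K (a * c)) h5
    replace h6 := congrArg (cons K (b * c)) h6
    replace h7 := congrArg (cons K (a * b * c)) h7
    simp only [map_add, LinearMap.add_apply] at h1 h3 ⊢
    simp only [qsh_cons_cons K a c, qsh_cons_cons K b c, qsh_cons_cons K (a * b) c,
      qsh_cons_cons K a b, qsh_cons_cons K a (b * c), ← mul_assoc]
    linear_combination (norm := abel) h1 + h2 + h3 + h4 + h5 + h6 + h7
termination_by u.length + v.length + w.length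

theorem qsh_assoc (x y z : Csh K D) : qsh K (qsh K x y) z = qsh K x (qsh K y z) := by
  have h1 : ∀ u v : List D, qsh K (qsh K (word K u) (word K v)) =
      qsh K (word K u) ∘ₗ qsh K (word K v) := fun u v =>
    hom_ext fun w => qsh_assoc_word K u v w
  have h2 : ∀ u : List D, qsh K ∘ₗ qsh K (word K u) =
      (LinearMap.llcomp K (Csh K D) (Csh K D) (Csh K D) (qsh K (word K u))) ∘ₗ qsh K :=
    fun u => hom_ext fun v => h1 u v
  have h3 : (qsh (D := D) K).compr₂ (qsh K) =
      (LinearMap.llcomp K (Csh K D) (Csh K D) (Csh K D) ∘ₗ qsh K).compl₂ (qsh K) :=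
    hom_ext fun u => h2 u
  exact congrArg (fun f : Csh K D →ₗ[K] Csh K D →ₗ[K] Csh K D →ₗ[K] Csh K D => f x y z) h3

instance : CommRing (Csh K D) where
  __ := (inferInstance : AddCommGroup (Csh K D))
  mul x y := qsh K x y
  one := word K []
  left_distrib x y z := (qsh K x).map_add y z
  right_distrib x y z := congrArg (fun f => f z) ((qsh K).map_add x y)
  zero_mul x := congrArg (fun f => f x) (qsh K).map_zero
  mul_zero x := (qsh K x).map_zero
  mul_assoc := qsh_assoc K
  one_mul := qsh_one_left K
  mul_one x := (qsh_comm K x _).trans (qsh_one_left K x)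
  mul_comm := qsh_comm K

instance : Algebra K (Csh K D) :=
  Algebra.ofModule (fun r x y => congrArg (fun f => f y) ((qsh K).map_smul r x))
    (fun r x y => (qsh K x).map_smul r y)

end Csh

namespace Csh

variable (K : Type v) [Field K] {D : Type u}

/-- The coproduct is deconcatenation; the counit is `1` on the empty word and `0` on all the other
words. -/
instance : CoalgebraStruct K (Csh K D) where
  comul := linearLift K fun w =>
    ∑ i ∈ Finset.range (w.length + 1), word K (w.take i) ⊗ₜ[K] word K (w.drop i)
  counit := linearLift K fun w => if w.length = 0 then 1 else 0

/-- The projection `π` onto the span `K(D)` of the words of length one. -/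
def toLetters : Csh K D →ₗ[K] MonoidAlgebra K D :=
  linearLift K fun w => match w with
    | [a] => MonoidAlgebra.single a 1
    | _ => 0

/-- Put an element of `K(D)` in front of words (bilinearly). -/
def consVec : MonoidAlgebra K D →ₗ[K] Csh K D →ₗ[K] Csh K D :=
  Finsupp.linearCombination K (fun a => cons K a) ∘ₗ
    (MonoidAlgebra.coeffLinearEquiv K : MonoidAlgebra K D ≃ₗ[K] _).toLinearMap

/-- The word `x₁ ⋯ xₙ` whose letters are elements of `K(D)`, expanded multilinearly. -/
def wordOfVec : List (MonoidAlgebra K D) → Csh K D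
  | [] => word K []
  | x :: l => consVec K x (wordOfVec l)

end Csh

/-! ### The combinatorial formula -/

section Formula

variable {K : Type v} [Field K] {D : Type u} [CommSemigroup D]

/-- The bracket-product of a finite nonempty family in `K(D)`, whose product is the bilinear
extension of the bracket `[ab] = a * b` of `D`. As `K(D)` need not have a unit, the product is
formed after adjoining one; the product of the empty family is never used. -/
def bracketProd {ι : Type*} (s : Finset ι) (f : ι → MonoidAlgebra K D) : MonoidAlgebra K D :=
  (∏ i ∈ s, (Unitization.inr (f i) : Unitization K (MonoidAlgebra K D))).snd

open Classical in
/-- `φ(σ⁻¹(i))`: the bracket-product of the values of `φ` at the connected components of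
`Part_e(F)` that `σ` maps to `i`. -/
def block (φ : (TreeClass D →₀ K) →ₗ[K] MonoidAlgebra K D) (F : DecForest D) (e : Finset F.V)
    {q : ℕ} (σ : (F.cont e).V → Fin q) (i : Fin q) : MonoidAlgebra K D :=
  bracketProd (Finset.univ.filter fun r : (F.part e).Component => σ r = i) fun r =>
    φ (Finsupp.single (TreeClass.mk ((F.part e).component r) ((F.part e).component_isTree r)) 1)

/-- `φ(σ⁻¹(q)) ⋯ φ(σ⁻¹(1))`. -/
def preorderWord (φ : (TreeClass D →₀ K) →ₗ[K] MonoidAlgebra K D) (F : DecForest D)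
    (e : Finset F.V) {q : ℕ} (σ : (F.cont e).V → Fin q) : Csh K D :=
  Csh.wordOfVec K (List.ofFn fun i : Fin q => block φ F e σ i.rev)

/-- `Φ` lifts `φ`: the restriction of `Φ` to the trees, followed by the projection `π`, is `φ`. -/
def Lifts (φ : (TreeClass D →₀ K) →ₗ[K] MonoidAlgebra K D) (Φ : HCK K D →ₐc[K] Csh K D) : Prop :=
  ∀ x, Csh.toLetters K (Φ (HCK.ofTrees K x)) = φ x

end Formula

end

/-! The admissible cuts of a forest correspond to its upsets (vertex sets closed under passing to
children), so the coproduct of a forest `c` is a sum of `a ⊗ b` over upsets, with `a` the forest on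
the upset and `b` the forest on its complement (`cutSum_eq_upSum`).

Uniqueness: in `Csh` every `x` equals `ε(x)·1` plus the sum of the words `π(x')x''` over the
coproduct of `x` (`Csh.eq_counit_add`). A coalgebra morphism `Φ` therefore satisfies `Φ(c) = ε(c)·1
+ ∑ π(Φ(a)) Φ(b)`, and is determined by `π ∘ Φ`. The pair `(ε, π)` is multiplicative with values in
the unitization of `K(D)`, and forests are generated by trees as a monoid, so `π ∘ Φ` sends a
nonempty forest to the bracket-product of the values of `φ` at its trees, and the empty forest to
`0` (`bracket`). Since `bracket` kills the empty forest, only forests `b` smaller than `c` matter in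
the recursion, and it has exactly one solution, `flagSum` (`eq_flagSum`).

Existence: that solution is a bialgebra morphism. It is multiplicative because the three terms of
`bracket_mul` match the three terms of the quasi-shuffle recursion (`flagSum_mul`), and
comultiplicative because splitting along upsets is coassociative (`comul_flagSum`).

Formula: unfolding the recursion gives a sum over flags of upsets, that is, over maps `τ : V → Fin
q` weakly increasing towards the roots (`layer_mk`). An empty fibre contributes `0`, so only
surjective `τ` count. Such a `τ` is the same as a pair `(e, σ)`: `e` is the set of edges along which
`τ` is constant, and `σ` is the reversal of the map that `τ` induces on the contraction by `e`
(`sum_linearPreorders`). -/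

noncomputable section

universe u v

/-! ### Edges and upsets of forests. -/

namespace RootedForest

variable (F : RootedForest)

theorem induce_parent_eq_some {p : F.V → Prop} {x y : (F.induce p).V} :
    (F.induce p).parent x = some y ↔ F.parent x.1 = some y.1 := by
  simp only [Option.bind_eq_some_iff]
  constructor
  · rintro ⟨u, hu, h⟩
    split_ifs at h with hp
    simp only [Option.some.injEq] at h
    simpa [← h] using hu
  · intro h
    refine ⟨y.1, h, ?_⟩
    rw [dif_pos y.2]

/-- A set of vertices closed under passing to the children. -/
def IsUpset (U : Finset F.V) : Prop := ∀ a b, F.parent a = some b → b ∈ U → a ∈ U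

variable {F} in
theorem IsUpset.mem_of_reach {U : Finset F.V} (hU : F.IsUpset U) {a b : F.V} (h : F.Reach a b)
    (hb : b ∈ U) : a ∈ U := by
  induction h using Relation.ReflTransGen.head_induction_on with
  | refl => exact hb
  | head h _ ih => exact hU _ _ h ih

open Classical in
/-- The upsets of `F`. -/
def upsets : Finset (Finset F.V) := Finset.univ.filter fun U => F.IsUpset U

variable {F} in
@[simp] theorem mem_upsets {U : Finset F.V} : U ∈ F.upsets ↔ F.IsUpset U := by
  simp [upsets]

theorem card_eq_of_equiv {F G : RootedForest} (e : F.V ≃ G.V) :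
    Fintype.card F.V = Fintype.card G.V :=
  Fintype.card_congr e

theorem union_inl_inl {F G : RootedForest} {x y : F.V} :
    (F.union G).parent (Sum.inl x) = some (Sum.inl y) ↔ F.parent x = some y := by
  simp

theorem union_inr_inr {F G : RootedForest} {x y : G.V} :
    (F.union G).parent (Sum.inr x) = some (Sum.inr y) ↔ G.parent x = some y := by
  simp

theorem union_inl_inr {F G : RootedForest} {x : F.V} {y : G.V} :
    (F.union G).parent (Sum.inl x) ≠ some (Sum.inr y) := by
  simp

theorem union_inr_inl {F G : RootedForest} {x : G.V} {y : F.V} :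
    (F.union G).parent (Sum.inr x) ≠ some (Sum.inl y) := by
  simp

end RootedForest

/-! ### Isomorphisms between induced forests. -/

namespace DecForest

variable {D : Type u}

/-- A bijection that preserves edges and decorations is an isomorphism. -/
def Iso.ofStep {F G : DecForest D} (f : F.V ≃ G.V)
    (h : ∀ x y, F.parent x = some y ↔ G.parent (f x) = some (f y))
    (hd : ∀ x, G.dec (f x) = F.dec x) : Iso F G where
  toEquiv := f
  parent_map x := by
    ext y
    obtain ⟨y, rfl⟩ := f.surjective y
    rw [← h, Option.map_eq_some_iff]
    constructor
    · intro hy; exact ⟨y, hy, rfl⟩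
    · rintro ⟨z, hz, hzy⟩
      rwa [← f.injective hzy]
  dec_map := hd

/-- An injective map on vertices that preserves edges and decorations identifies corresponding
induced forests. -/
theorem mk_induce_eq_of_embedding {F G : DecForest D} {p : F.V → Prop} {p' : G.V → Prop}
    (f : F.V → G.V) (hf : ∀ x y, p x → p y → f x = f y → x = y)
    (hp : ∀ x, p x → p' (f x)) (hs : ∀ y, p' y → ∃ x, p x ∧ f x = y)
    (h : ∀ x y, p x → p y → (F.parent x = some y ↔ G.parent (f x) = some (f y)))
    (hd : ∀ x, p x → G.dec (f x) = F.dec x) :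
    ForestClass.mk (F.induce p) = ForestClass.mk (G.induce p') := by
  refine Quotient.sound ⟨Iso.ofStep (Equiv.ofBijective
    (fun x : {x // p x} => (⟨f x.1, hp x.1 x.2⟩ : {x // p' x})) ⟨?_, ?_⟩) ?_ ?_⟩
  · rintro ⟨x, hx⟩ ⟨y, hy⟩ hxy
    exact Subtype.ext (hf x y hx hy (congrArg Subtype.val hxy))
  · rintro ⟨y, hy⟩
    obtain ⟨x, hx, rfl⟩ := hs y hy
    exact ⟨⟨x, hx⟩, rfl⟩
  · rintro x y
    exact (F.toRootedForest.induce_parent_eq_some (x := x) (y := y)).trans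
      ((h x.1 y.1 x.2 y.2).trans (G.toRootedForest.induce_parent_eq_some (p := p')
        (x := ⟨f x.1, hp x.1 x.2⟩) (y := ⟨f y.1, hp y.1 y.2⟩)).symm)
  · rintro x
    exact hd x.1 x.2

/-- Inducing twice. -/
theorem mk_induce_induce (F : DecForest D) {p : F.V → Prop} {p' : (F.induce p).V → Prop}
    {p'' : F.V → Prop} (h : ∀ x, p'' x ↔ ∃ hx : p x, p' ⟨x, hx⟩) :
    ForestClass.mk ((F.induce p).induce p') = ForestClass.mk (F.induce p'') := by
  refine mk_induce_eq_of_embedding (F := F.induce p) (G := F) Subtype.val ?_ ?_ ?_ ?_ ?_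
  · intro x y _ _ h; exact Subtype.ext h
  · intro x hx; exact (h x.1).2 ⟨x.2, hx⟩
  · intro y hy
    obtain ⟨hx, hx'⟩ := (h y).1 hy
    exact ⟨⟨y, hx⟩, hx', rfl⟩
  · intro x y _ _
    exact F.toRootedForest.induce_parent_eq_some
  · intro x _; rfl

theorem mk_induce_congr (F : DecForest D) {p p' : F.V → Prop} (h : ∀ x, p x ↔ p' x) :
    ForestClass.mk (F.induce p) = ForestClass.mk (F.induce p') := by
  rw [show p = p' from funext fun x => propext (h x)]

theorem mk_induce_true (F : DecForest D) {p : F.V → Prop} (h : ∀ x, p x) :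
    ForestClass.mk (F.induce p) = ForestClass.mk F := by
  refine Quotient.sound ⟨Iso.ofStep (F := F.induce p) (Equiv.subtypeUnivEquiv h) ?_ ?_⟩
  · intro x y
    exact F.toRootedForest.induce_parent_eq_some
  · intro x; rfl

end DecForest

/-! ### Sums over upsets and their bialgebra identities. -/

namespace ForestClass

variable {D : Type u}

theorem exists_mk (c : ForestClass D) : ∃ F, mk F = c := Quotient.exists_rep c

theorem mk_mul_mk (F G : DecForest D) : mk F * mk G = mk (F.union G) := rfl

/-- The number of vertices. -/
def card : ForestClass D → ℕ :=
  Quotient.lift (fun F : DecForest D => Fintype.card F.V) fun _ _ ⟨f⟩ =>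
    Fintype.card_congr f.toEquiv

theorem mk_eq_one_iff {F : DecForest D} : mk F = 1 ↔ IsEmpty F.V := by
  constructor
  · intro h
    obtain ⟨f⟩ : Nonempty (DecForest.Iso F (DecForest.empty D)) := Quotient.exact h
    exact ⟨fun x => (f.toEquiv x).elim⟩
  · intro h
    exact Quotient.sound ⟨DecForest.Iso.ofStep (G := DecForest.empty D)
      (Equiv.equivOfIsEmpty F.V Empty) (fun x => h.elim x) fun x => h.elim x⟩

theorem card_eq_zero_iff {c : ForestClass D} : c.card = 0 ↔ c = 1 := by
  obtain ⟨F⟩ := c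
  exact Fintype.card_eq_zero_iff.trans mk_eq_one_iff.symm

@[simp] theorem card_one : (1 : ForestClass D).card = 0 := card_eq_zero_iff.2 rfl

theorem card_mul (c d : ForestClass D) : (c * d).card = c.card + d.card := by
  obtain ⟨F⟩ := c
  obtain ⟨G⟩ := d
  exact Fintype.card_sum

theorem mul_eq_one_iff {c d : ForestClass D} : c * d = 1 ↔ c = 1 ∧ d = 1 := by
  simp only [← card_eq_zero_iff, card_mul, Nat.add_eq_zero_iff]

variable {M : Type*} [AddCommMonoid M]

/-- The sum over the upsets `U` of a forest of the values of a function at the forests induced on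
`U` and on its complement. -/
def upSum : ForestClass D → (ForestClass D → ForestClass D → M) → M :=
  Quotient.lift (fun (F : DecForest D) f =>
    ∑ U ∈ F.upsets, f (mk (F.induce (· ∈ U))) (mk (F.induce (· ∉ U)))) <| by
    rintro F G ⟨g⟩
    funext f
    refine Finset.sum_equiv (Equiv.finsetCongr g.toEquiv) ?_ ?_
    · intro U
      simp only [RootedForest.mem_upsets, RootedForest.IsUpset]
      constructor
      · intro h a b hab hb
        obtain ⟨a, rfl⟩ := g.toEquiv.surjective a
        obtain ⟨b, rfl⟩ := g.toEquiv.surjective b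
        simp only [Equiv.finsetCongr_apply, Finset.mem_map_equiv, Equiv.symm_apply_apply] at hb ⊢
        exact h a b ((g.step_iff a b).1 hab) hb
      · intro h a b hab hb
        have := h (g.toEquiv a) (g.toEquiv b) ((g.step_iff a b).2 hab)
        simp only [Equiv.finsetCongr_apply, Finset.mem_map_equiv, Equiv.symm_apply_apply] at this
        exact this hb
    · intro U _
      congr 1
      · exact Quotient.sound ⟨g.induce fun x => by simp⟩
      · exact Quotient.sound ⟨g.induce fun x => by simp⟩

theorem upSum_mk (F : DecForest D) (f : ForestClass D → ForestClass D → M) :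
    upSum (mk F) f = ∑ U ∈ F.upsets, f (mk (F.induce (· ∈ U))) (mk (F.induce (· ∉ U))) := rfl

theorem card_induce_add (F : DecForest D) (U : Finset F.V) :
    (mk (F.induce (· ∈ U))).card + (mk (F.induce (· ∉ U))).card = (mk F).card := by
  classical
  rw [← card_mul]
  exact RootedForest.card_eq_of_equiv (F := ((F.induce (· ∈ U)).union (F.induce (· ∉ U))).1)
    (Equiv.sumCompl (· ∈ U))

/-- The vertex count available in the hypothesis is what lets an induction on the number of vertices
be used under the sum. -/
theorem upSum_congr {c : ForestClass D} {f g : ForestClass D → ForestClass D → M}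
    (h : ∀ a b, a.card + b.card = c.card → f a b = g a b) : upSum c f = upSum c g := by
  obtain ⟨F⟩ := c
  exact Finset.sum_congr rfl fun U _ => h _ _ (card_induce_add F U)

theorem upSum_add (c : ForestClass D) (f g : ForestClass D → ForestClass D → M) :
    upSum c (fun a b => f a b + g a b) = upSum c f + upSum c g := by
  obtain ⟨F⟩ := c
  exact Finset.sum_add_distrib

theorem upSum_zero (c : ForestClass D) : upSum c (fun _ _ => (0 : M)) = 0 := by
  obtain ⟨F⟩ := c
  exact Finset.sum_const_zero

theorem map_upSum {N G : Type*} [AddCommMonoid N] [FunLike G M N] [AddMonoidHomClass G M N]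
    (g : G) (c : ForestClass D) (f : ForestClass D → ForestClass D → M) :
    g (upSum c f) = upSum c fun a b => g (f a b) := by
  obtain ⟨F⟩ := c
  exact map_sum g _ _

theorem upSum_sum {ι : Type*} (s : Finset ι) (c : ForestClass D)
    (f : ι → ForestClass D → ForestClass D → M) :
    upSum c (fun a b => ∑ i ∈ s, f i a b) = ∑ i ∈ s, upSum c (f i) := by
  obtain ⟨F⟩ := c
  exact Finset.sum_comm

theorem upSum_comm (c d : ForestClass D)
    (f : ForestClass D → ForestClass D → ForestClass D → ForestClass D → M) :
    upSum c (fun a b => upSum d (f a b)) = upSum d fun a' b' => upSum c fun a b => f a b a' b' := by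
  obtain ⟨F⟩ := c
  obtain ⟨G⟩ := d
  exact Finset.sum_comm

open Classical in
-- Only the empty upset induces the empty forest; this is a counit axiom in terms of upsets.
theorem upSum_ite_left (c : ForestClass D) (f : ForestClass D → ForestClass D → M) :
    upSum c (fun a b => if a = 1 then f a b else 0) = f 1 c := by
  obtain ⟨F, rfl⟩ := exists_mk c
  have key : ∀ U : Finset F.V, mk (F.induce (· ∈ U)) = 1 ↔ U = ∅ := fun U => by
    rw [mk_eq_one_iff, isEmpty_subtype, Finset.eq_empty_iff_forall_notMem]
  rw [upSum_mk, Finset.sum_eq_single ∅]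
  · rw [if_pos ((key _).2 rfl), (key _).2 rfl]
    congr 1
    exact F.mk_induce_true fun x => Finset.notMem_empty x
  · intro U _ hU
    exact if_neg fun h => hU ((key U).1 h)
  · intro h
    exact (h (by simp [RootedForest.IsUpset])).elim

open Classical in
theorem upSum_ite_right (c : ForestClass D) (f : ForestClass D → ForestClass D → M) :
    upSum c (fun a b => if b = 1 then f a b else 0) = f c 1 := by
  obtain ⟨F, rfl⟩ := exists_mk c
  have key : ∀ U : Finset F.V, mk (F.induce (· ∉ U)) = 1 ↔ U = Finset.univ := fun U => by
    rw [mk_eq_one_iff, isEmpty_subtype, Finset.eq_univ_iff_forall]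
    simp
  rw [upSum_mk, Finset.sum_eq_single Finset.univ]
  · rw [if_pos ((key _).2 rfl), (key _).2 rfl]
    congr 1
    exact F.mk_induce_true fun x => Finset.mem_univ x
  · intro U _ hU
    exact if_neg fun h => hU ((key U).1 h)
  · intro h
    exact (h (by simp [RootedForest.IsUpset])).elim

theorem upSum_one (f : ForestClass D → ForestClass D → M) : upSum 1 f = f 1 1 := by
  classical
  rw [← upSum_ite_left 1 f]
  refine upSum_congr fun a b h => ?_
  rw [if_pos]
  rw [← card_eq_zero_iff]
  simp at h
  exact h.1

open Classical in
/-- The upsets of an induced forest, as sets of vertices of the ambient forest. -/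
theorem upSum_induce (F : DecForest D) (p : F.V → Prop) (f : ForestClass D → ForestClass D → M) :
    upSum (mk (F.induce p)) f =
      ∑ U ∈ Finset.univ.filter fun U : Finset F.V => (∀ v ∈ U, p v) ∧
        ∀ a b, p a → F.parent a = some b → b ∈ U → a ∈ U,
        f (mk (F.induce (· ∈ U))) (mk (F.induce fun v => p v ∧ v ∉ U)) := by
  rw [upSum_mk]
  refine Finset.sum_bij' (fun W _ => W.map (Function.Embedding.subtype p))
    (fun U _ => U.subtype p) ?_ ?_ ?_ ?_ ?_
  · intro W hW
    rw [RootedForest.mem_upsets] at hW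
    simp only [Finset.mem_filter, Finset.mem_univ, true_and, Finset.mem_map,
      Function.Embedding.coe_subtype, Subtype.exists, exists_and_right, exists_eq_right]
    refine ⟨fun v ⟨h, _⟩ => h, ?_⟩
    rintro a b ha hab ⟨hb, hb'⟩
    exact ⟨ha, hW ⟨a, ha⟩ ⟨b, hb⟩ (F.toRootedForest.induce_parent_eq_some.2 hab) hb'⟩
  · intro U hU
    rw [Finset.mem_filter_univ] at hU
    rw [RootedForest.mem_upsets]
    intro a b hab hb
    rw [Finset.mem_subtype] at hb ⊢
    exact hU.2 _ _ a.2 (F.toRootedForest.induce_parent_eq_some.1 hab) hb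
  · intro W _
    ext x
    simpa using fun _ => x.2
  · intro U hU
    rw [Finset.mem_filter_univ] at hU
    exact Finset.subtype_map_of_mem hU.1
  · intro W _
    congr 1
    · exact F.mk_induce_induce fun x => by simp
    · refine F.mk_induce_induce fun x => ?_
      simp only [Finset.mem_map, Function.Embedding.coe_subtype, Subtype.exists, exists_and_right,
        exists_eq_right]
      constructor
      · rintro ⟨h, h'⟩
        exact ⟨h, fun h'' => h' ⟨h, h''⟩⟩
      · rintro ⟨h, h'⟩
        exact ⟨h, fun ⟨_, h''⟩ => h' h''⟩

/-- Splitting the lower part again is the same as splitting the upper part again. -/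
theorem upSum_coassoc (c : ForestClass D)
    (f : ForestClass D → ForestClass D → ForestClass D → M) :
    upSum c (fun a b => upSum b fun a' b' => f a a' b') =
      upSum c fun a b => upSum a fun a' a'' => f a' a'' b := by
  classical
  obtain ⟨F⟩ := c
  change ∑ U ∈ F.upsets, _ = ∑ U ∈ F.upsets, _
  simp only [upSum_induce]
  rw [Finset.sum_sigma', Finset.sum_sigma']
  -- An upset `U` with an upset `W` of its complement is the same as a nested pair of upsets `U ⊆ U
  -- ∪ W`.
  refine Finset.sum_bij' (fun x _ => ⟨x.1 ∪ x.2, x.1⟩) (fun x _ => ⟨x.2, x.1 \ x.2⟩) ?_ ?_ ?_ ?_ ?_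
  · rintro ⟨U, W⟩ h
    simp only [Finset.mem_sigma, RootedForest.mem_upsets, Finset.mem_filter_univ,
      RootedForest.IsUpset, Finset.mem_union] at h ⊢
    obtain ⟨h1, h2, h3⟩ := h
    refine ⟨fun a b hab hb => ?_, fun v hv => Or.inl hv, fun a b _ hab hb => h1 a b hab hb⟩
    by_cases ha : a ∈ U
    · exact Or.inl ha
    · rcases hb with hb | hb
      · exact Or.inl (h1 a b hab hb)
      · exact Or.inr (h3 a b ha hab hb)
  · rintro ⟨X, U⟩ h
    simp only [Finset.mem_sigma, RootedForest.mem_upsets, Finset.mem_filter_univ,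
      RootedForest.IsUpset, Finset.mem_sdiff] at h ⊢
    obtain ⟨h1, h2, h3⟩ := h
    exact ⟨fun a b hab hb => h3 a b (h1 a b hab (h2 b hb)) hab hb, fun v hv => hv.2,
      fun a b ha hab hb => ⟨h1 a b hab hb.1, ha⟩⟩
  · rintro ⟨U, W⟩ h
    simp only [Finset.mem_sigma, Finset.mem_filter_univ] at h
    simp only [Sigma.mk.injEq, heq_eq_eq, true_and]
    ext x
    have := h.2.1 x
    simp only [Finset.mem_sdiff, Finset.mem_union]
    tauto
  · rintro ⟨X, U⟩ h
    simp only [Finset.mem_sigma, Finset.mem_filter_univ] at h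
    simp only [Sigma.mk.injEq, heq_eq_eq, and_true]
    exact Finset.union_sdiff_of_subset h.2.1
  · rintro ⟨U, W⟩ h
    simp only [Finset.mem_sigma, Finset.mem_filter_univ] at h
    dsimp only
    congr 1
    · refine F.mk_induce_congr fun x => ?_
      have := h.2.1 x
      simp only [Finset.mem_union]
      tauto
    · refine F.mk_induce_congr fun x => ?_
      simp only [Finset.mem_union]
      tauto

/-- An upset of a disjoint union is a pair of upsets, one in each part. This is the multiplicativity
of the coproduct. -/
theorem upSum_mul (c d : ForestClass D) (f : ForestClass D → ForestClass D → M) :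
    upSum (c * d) f = upSum c fun a b => upSum d fun a' b' => f (a * a') (b * b') := by
  classical
  obtain ⟨F⟩ := c
  obtain ⟨G⟩ := d
  have key : ∀ (p : (F.union G).V → Prop), mk ((F.union G).induce p) =
      mk (F.induce fun x => p (Sum.inl x)) * mk (G.induce fun x => p (Sum.inr x)) := by
    intro p
    refine Quotient.sound ⟨DecForest.Iso.ofStep (Equiv.subtypeSum) ?_ ?_⟩
    · intro x y
      refine ((F.union G).toRootedForest.induce_parent_eq_some).trans ?_
      rcases x with ⟨x | x, hx⟩ <;> rcases y with ⟨y | y, hy⟩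
      · exact RootedForest.union_inl_inl.trans
          ((F.toRootedForest.induce_parent_eq_some (p := fun x => p (Sum.inl x)) (x := ⟨x, hx⟩)
            (y := ⟨y, hy⟩)).symm.trans (RootedForest.union_inl_inl (x := ⟨x, hx⟩) (y := ⟨y, hy⟩)
              (F := F.toRootedForest.induce _) (G := G.toRootedForest.induce _)).symm)
      · exact iff_of_false RootedForest.union_inl_inr RootedForest.union_inl_inr
      · exact iff_of_false RootedForest.union_inr_inl RootedForest.union_inr_inl
      · exact RootedForest.union_inr_inr.trans
          ((G.toRootedForest.induce_parent_eq_some (p := fun x => p (Sum.inr x)) (x := ⟨x, hx⟩)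
            (y := ⟨y, hy⟩)).symm.trans (RootedForest.union_inr_inr (x := ⟨x, hx⟩) (y := ⟨y, hy⟩)
              (F := F.toRootedForest.induce _) (G := G.toRootedForest.induce _)).symm)
    · rintro ⟨x | x, hx⟩ <;> rfl
  change ∑ U ∈ (F.union G).upsets, _ = ∑ U ∈ F.upsets, ∑ W ∈ G.upsets, _
  rw [← Finset.sum_product']
  refine Finset.sum_bij' (fun U _ => (U.toLeft, U.toRight)) (fun x _ => x.1.disjSum x.2)
    ?_ ?_ ?_ ?_ ?_
  · intro U hU
    rw [RootedForest.mem_upsets] at hU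
    rw [Finset.mem_product, RootedForest.mem_upsets, RootedForest.mem_upsets]
    constructor
    · intro a b hab hb
      rw [Finset.mem_toLeft] at hb ⊢
      exact hU _ _ (RootedForest.union_inl_inl.2 hab) hb
    · intro a b hab hb
      rw [Finset.mem_toRight] at hb ⊢
      exact hU _ _ (RootedForest.union_inr_inr.2 hab) hb
  · rintro ⟨U, W⟩ h
    rw [Finset.mem_product, RootedForest.mem_upsets, RootedForest.mem_upsets] at h
    rw [RootedForest.mem_upsets]
    rintro (a | a) (b | b) hab hb
    · rw [Finset.inl_mem_disjSum] at hb ⊢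
      exact h.1 a b (RootedForest.union_inl_inl.1 hab) hb
    · exact (RootedForest.union_inl_inr hab).elim
    · exact (RootedForest.union_inr_inl hab).elim
    · rw [Finset.inr_mem_disjSum] at hb ⊢
      exact h.2 a b (RootedForest.union_inr_inr.1 hab) hb
  · intro U _
    exact Finset.toLeft_disjSum_toRight
  · rintro ⟨U, W⟩ _
    simp
  · intro U _
    rw [key, key]
    simp only [Finset.mem_toLeft, Finset.mem_toRight]

end ForestClass

/-! ### Admissible cuts as upsets. -/

namespace HCK

variable (K : Type v) [Field K] {D : Type u}

theorem cutSum_eq_upSum (F : DecForest D) :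
    cutSum K F = (ForestClass.mk F).upSum fun a b => of K a ⊗ₜ[K] of K b := by
  classical
  rw [ForestClass.upSum_mk, cutSum]
  -- A cut generates the upset of the vertices above it. It is recovered as the set of the vertices
  -- of the upset that are lowest, i.e. whose parent, if any, lies outside.
  refine Finset.sum_bij' (fun c _ => Finset.univ.filter fun w => F.Above c w)
    (fun U _ => U.filter fun v => ∀ u, F.parent v = some u → u ∉ U) ?_ ?_ ?_ ?_ ?_
  · intro c _
    rw [RootedForest.mem_upsets]
    intro a b hab hb
    rw [Finset.mem_filter_univ] at hb ⊢
    obtain ⟨v, hv, hbv⟩ := hb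
    exact ⟨v, hv, Relation.ReflTransGen.head hab hbv⟩
  · intro U hU
    rw [RootedForest.mem_upsets] at hU
    rw [Finset.mem_filter_univ]
    intro a ha b hb hab h
    rw [Finset.mem_filter] at ha hb
    rcases Relation.ReflTransGen.cases_head h with h | ⟨u, hu, hub⟩
    · exact hab h
    · exact ha.2 u hu (hU.mem_of_reach hub hb.1)
  · intro c hc
    rw [Finset.mem_filter_univ] at hc
    ext v
    simp only [Finset.mem_filter, Finset.mem_univ, true_and]
    constructor
    · rintro ⟨⟨w, hw, hvw⟩, h⟩
      rcases Relation.ReflTransGen.cases_head hvw with h' | ⟨u, hu, huw⟩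
      · rwa [h']
      · exact (h u hu ⟨w, hw, huw⟩).elim
    · intro hv
      refine ⟨⟨v, hv, Relation.ReflTransGen.refl⟩, ?_⟩
      rintro u hu ⟨w, hw, huw⟩
      have hvw : F.Reach v w := Relation.ReflTransGen.head hu huw
      by_cases h : v = w
      · subst h
        exact F.acyclic v (Relation.TransGen.head' hu huw)
      · exact hc v hv w hw h hvw
  · intro U hU
    rw [RootedForest.mem_upsets] at hU
    ext w
    simp only [Finset.mem_filter, Finset.mem_univ, true_and]
    constructor
    · rintro ⟨v, hv, hwv⟩
      rw [Finset.mem_filter] at hv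
      exact hU.mem_of_reach hwv hv.1
    · intro hw
      obtain ⟨r, hr, hr'⟩ := F.exists_root w
      -- Going down the path from a vertex of `U` to the root, the last vertex before leaving `U`
      -- (or the root itself) belongs to the cut.
      have : ∀ a, F.Reach a r → a ∈ U → F.Above
          (U.filter fun v => ∀ u, F.parent v = some u → u ∉ U) a := by
        intro a ha
        induction ha using Relation.ReflTransGen.head_induction_on with
        | refl =>
          intro hU
          exact ⟨r, Finset.mem_filter.2 ⟨hU, by simp [hr']⟩, Relation.ReflTransGen.refl⟩
        | @head a b hab _ ih =>
          intro ha
          by_cases hb : b ∈ U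
          · obtain ⟨v, hv, hbv⟩ := ih hb
            exact ⟨v, hv, Relation.ReflTransGen.head hab hbv⟩
          · refine ⟨a, Finset.mem_filter.2 ⟨ha, fun u hu => ?_⟩, Relation.ReflTransGen.refl⟩
            have : u = b := Option.some.inj (hu.symm.trans hab)
            rwa [this]
      exact this w hr hw
  · intro c _
    congr 2
    · exact F.mk_induce_congr fun x => by simp
    · exact F.mk_induce_congr fun x => by simp

end HCK

/-! ### Forests as products of trees. -/

namespace RootedForest

variable {F G : RootedForest}

theorem union_reach_inl {a : F.V} {y : (F.union G).V} :
    (F.union G).Reach y (Sum.inl a) ↔ ∃ b, y = Sum.inl b ∧ F.Reach b a := by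
  constructor
  · intro h
    induction h using Relation.ReflTransGen.head_induction_on with
    | refl => exact ⟨a, rfl, Relation.ReflTransGen.refl⟩
    | @head x y hxy _ ih =>
      obtain ⟨b, rfl, hb⟩ := ih
      rcases x with x | x
      · exact ⟨x, rfl, Relation.ReflTransGen.head (union_inl_inl.1 hxy) hb⟩
      · exact (union_inr_inl hxy).elim
  · rintro ⟨b, rfl, hb⟩
    exact Relation.ReflTransGen.lift Sum.inl (fun x y h => union_inl_inl.2 h) _ _ hb

theorem union_reach_inr {a : G.V} {y : (F.union G).V} :
    (F.union G).Reach y (Sum.inr a) ↔ ∃ b, y = Sum.inr b ∧ G.Reach b a := by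
  constructor
  · intro h
    induction h using Relation.ReflTransGen.head_induction_on with
    | refl => exact ⟨a, rfl, Relation.ReflTransGen.refl⟩
    | @head x y hxy _ ih =>
      obtain ⟨b, rfl, hb⟩ := ih
      rcases x with x | x
      · exact (union_inl_inr hxy).elim
      · exact ⟨x, rfl, Relation.ReflTransGen.head (union_inr_inr.1 hxy) hb⟩
  · rintro ⟨b, rfl, hb⟩
    exact Relation.ReflTransGen.lift Sum.inr (fun x y h => union_inr_inr.2 h) _ _ hb

theorem IsTree.reach_root (h : F.IsTree) {r : F.V} (hr : F.parent r = none) (v : F.V) :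
    F.Reach v r := by
  obtain ⟨s, hs, hs'⟩ := F.exists_root v
  rwa [h.unique hr hs']

/-- The components of a disjoint union. -/
def componentUnion (F G : RootedForest) : (F.union G).Component ≃ F.Component ⊕ G.Component where
  toFun r := match r with
    | ⟨Sum.inl x, h⟩ => Sum.inl ⟨x, Option.map_eq_none_iff.1 h⟩
    | ⟨Sum.inr x, h⟩ => Sum.inr ⟨x, Option.map_eq_none_iff.1 h⟩
  invFun := Sum.elim (fun x => ⟨Sum.inl x.1, Option.map_eq_none_iff.2 x.2⟩)
    (fun x => ⟨Sum.inr x.1, Option.map_eq_none_iff.2 x.2⟩)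
  left_inv := by rintro ⟨x | x, h⟩ <;> rfl
  right_inv := by rintro (x | x) <;> rfl

end RootedForest

namespace DecForest

variable {D : Type u}

/-- The class of the component with root `r`. -/
def componentClass (F : DecForest D) (r : F.Component) : TreeClass D :=
  TreeClass.mk (F.component r) (F.component_isTree r)

theorem componentClass_inl (F G : DecForest D) (r : F.Component) :
    (F.union G).componentClass ((F.componentUnion G.1).symm (Sum.inl r)) = F.componentClass r := by
  refine Subtype.ext (mk_induce_eq_of_embedding Sum.inl ?_ ?_ ?_ ?_ ?_).symm
  · intro x y _ _ h; exact Sum.inl_injective h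
  · intro x hx; exact RootedForest.union_reach_inl.2 ⟨x, rfl, hx⟩
  · intro y hy
    obtain ⟨b, rfl, hb⟩ := RootedForest.union_reach_inl.1 hy
    exact ⟨b, hb, rfl⟩
  · intro x y _ _; exact RootedForest.union_inl_inl.symm
  · intro x _; rfl

theorem componentClass_inr (F G : DecForest D) (r : G.Component) :
    (F.union G).componentClass ((F.componentUnion G.1).symm (Sum.inr r)) = G.componentClass r := by
  refine Subtype.ext (mk_induce_eq_of_embedding Sum.inr ?_ ?_ ?_ ?_ ?_).symm
  · intro x y _ _ h; exact Sum.inr_injective h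
  · intro x hx; exact RootedForest.union_reach_inr.2 ⟨x, rfl, hx⟩
  · intro y hy
    obtain ⟨b, rfl, hb⟩ := RootedForest.union_reach_inr.1 hy
    exact ⟨b, hb, rfl⟩
  · intro x y _ _; exact RootedForest.union_inr_inr.symm
  · intro x _; rfl

theorem componentClass_of_isTree {F : DecForest D} (h : F.IsTree) (r : F.Component) :
    F.componentClass r = TreeClass.mk F h :=
  Subtype.ext (F.mk_induce_true fun x => RootedForest.IsTree.reach_root h r.2 x)

/-- A predicate that is constant along edges cuts no edge, so it selects a union of components. -/
theorem mk_eq_mul_of_parent (F : DecForest D) (p : F.V → Prop)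
    (h : ∀ x y, F.parent x = some y → (p x ↔ p y)) :
    ForestClass.mk F = ForestClass.mk (F.induce p) * ForestClass.mk (F.induce fun x => ¬ p x) := by
  classical
  refine Eq.symm (Quotient.sound ⟨Iso.ofStep (F := (F.induce p).union (F.induce fun x => ¬ p x))
    (Equiv.sumCompl p) ?_ ?_⟩)
  · rintro (x | x) (y | y)
    · exact RootedForest.union_inl_inl.trans F.toRootedForest.induce_parent_eq_some
    · exact iff_of_false RootedForest.union_inl_inr fun hxy => y.2 ((h _ _ hxy).1 x.2)
    · exact iff_of_false RootedForest.union_inr_inl fun hxy => x.2 ((h _ _ hxy).2 y.2)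
    · exact RootedForest.union_inr_inr.trans F.toRootedForest.induce_parent_eq_some
  · rintro (x | x) <;> rfl

end DecForest

namespace ForestClass

variable {D : Type u} {N : Type*} [CommMonoid N]

open Classical in
/-- The product over the components of a forest of the values of a function on trees. -/
def treeProd (f : TreeClass D → N) : ForestClass D → N :=
  Quotient.lift (fun F : DecForest D => ∏ r : F.Component, f (F.componentClass r)) <| by
    rintro F G ⟨g⟩
    refine Fintype.prod_equiv (g.toEquiv.subtypeEquiv fun x => by simp [g.parent_map]) _ _ ?_
    intro r
    congr 1
    exact Subtype.ext (Quotient.sound ⟨g.induce fun x => (g.reach_iff _ _).symm⟩)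

open Classical in
theorem treeProd_mk (f : TreeClass D → N) (F : DecForest D) :
    treeProd f (mk F) = ∏ r : F.Component, f (F.componentClass r) := rfl

/-- The forests form the free commutative monoid on the trees. -/
def treeLift (f : TreeClass D → N) : ForestClass D →* N where
  toFun := treeProd f
  map_one' := by
    have : IsEmpty (DecForest.empty D).Component := ⟨fun x => x.1.elim⟩
    exact Fintype.prod_empty _
  map_mul' c d := by
    classical
    obtain ⟨F, rfl⟩ := exists_mk c
    obtain ⟨G, rfl⟩ := exists_mk d
    rw [mk_mul_mk, treeProd_mk, treeProd_mk, treeProd_mk,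
      ← (F.componentUnion G.1).symm.prod_comp, Fintype.prod_sum_type]
    simp only [DecForest.componentClass_inl, DecForest.componentClass_inr]

open Classical in
theorem treeLift_mk (f : TreeClass D → N) (F : DecForest D) :
    treeLift f (mk F) = ∏ r : F.Component, f (F.componentClass r) := rfl

theorem treeLift_tree (f : TreeClass D → N) (t : TreeClass D) : treeLift f t.1 = f t := by
  classical
  obtain ⟨c, h⟩ := t
  obtain ⟨F, rfl⟩ := exists_mk c
  change F.IsTree at h
  rw [treeLift_mk]
  obtain ⟨r, hr, hr'⟩ := id h
  rw [Fintype.prod_eq_single ⟨r, hr⟩]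
  · rw [DecForest.componentClass_of_isTree h]
    rfl
  · rintro ⟨s, hs⟩ hne
    exact (hne (Subtype.ext (hr' s hs))).elim

/-- Trees generate the monoid: the component of any vertex splits off as a tree factor and leaves a
smaller forest. -/
theorem hom_ext_tree {f g : ForestClass D →* N} (h : ∀ t : TreeClass D, f t.1 = g t.1) :
    f = g := by
  ext c
  induction hn : c.card using Nat.strong_induction_on generalizing c with
  | _ n ih =>
    obtain ⟨F, rfl⟩ := exists_mk c
    rcases isEmpty_or_nonempty F.V with hF | ⟨⟨v⟩⟩
    · rw [mk_eq_one_iff.2 hF, map_one, map_one]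
    · obtain ⟨r, -, hr⟩ := F.exists_root v
      have e := F.mk_eq_mul_of_parent (fun x => F.Reach x r) fun x y hxy => by
        constructor
        · intro hx
          rcases Relation.ReflTransGen.cases_head hx with rfl | ⟨z, hz, hzr⟩
          · exact (Option.some_ne_none _ (hxy.symm.trans hr)).elim
          · rwa [Option.some.inj (hxy.symm.trans hz)]
        · intro hy
          exact Relation.ReflTransGen.head hxy hy
      have ht := h (F.componentClass ⟨r, hr⟩)
      change f (mk (F.induce fun x => F.Reach x r)) = g (mk (F.induce fun x => F.Reach x r)) at ht
      have hc := congrArg card e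
      rw [card_mul] at hc
      have hpos : (mk (F.induce fun x => F.Reach x r)).card ≠ 0 := by
        rw [Ne, card_eq_zero_iff, mk_eq_one_iff, not_isEmpty_iff]
        exact ⟨⟨r, Relation.ReflTransGen.refl⟩⟩
      rw [e, map_mul, map_mul, ht, ih _ (by omega) _ rfl]

end ForestClass

/-! ### Maps out of the Connes–Kreimer algebra. -/

namespace MonoidAlgebra

theorem linearMap_ext_single {K D M : Type*} [Field K] [AddCommMonoid M] [Module K M]
    {f g : MonoidAlgebra K D →ₗ[K] M} (h : ∀ a, f (single a 1) = g (single a 1)) : f = g := by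
  refine LinearMap.ext fun x => ?_
  induction x using MonoidAlgebra.induction_linear with
  | zero => simp
  | add x y hx hy => rw [map_add, map_add, hx, hy]
  | single a r =>
    have : single a r = r • (single a 1 : MonoidAlgebra K D) := by simp
    rw [this, map_smul, map_smul, h]

end MonoidAlgebra

namespace HCK

variable (K : Type v) [Field K] {D : Type u}

theorem linearLift_of {M : Type*} [AddCommMonoid M] [Module K M] (f : ForestClass D → M)
    (c : ForestClass D) : linearLift K f (of K c) = f c := by
  change Finsupp.linearCombination K f (Finsupp.single c 1) = f c
  rw [Finsupp.linearCombination_single, one_smul]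

variable {K} in
theorem hom_ext {M : Type*} [AddCommMonoid M] [Module K M] {f g : HCK K D →ₗ[K] M}
    (h : ∀ c, f (of K c) = g (of K c)) : f = g :=
  MonoidAlgebra.linearMap_ext_single h

theorem comul_of (c : ForestClass D) :
    CoalgebraStruct.comul (R := K) (of K c) = c.upSum fun a b => of K a ⊗ₜ[K] of K b := by
  obtain ⟨F, rfl⟩ := ForestClass.exists_mk c
  rw [← cutSum_eq_upSum]
  exact linearLift_of K _ _

open Classical in
theorem counit_of (c : ForestClass D) :
    CoalgebraStruct.counit (R := K) (of K c) = if c = 1 then 1 else 0 :=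
  linearLift_of K _ _

theorem ofTrees_single (t : TreeClass D) : ofTrees K (Finsupp.single t 1) = of K t.1 := by
  rw [ofTrees, Finsupp.linearCombination_single, one_smul]

/-- The algebra morphism extending a multiplicative map on forests. -/
def algLift {A : Type*} [CommRing A] [Algebra K A] (f : ForestClass D →* A) : HCK K D →ₐ[K] A :=
  MonoidAlgebra.lift K A (ForestClass D) f

theorem algLift_of {A : Type*} [CommRing A] [Algebra K A] (f : ForestClass D →* A)
    (c : ForestClass D) : algLift K f (of K c) = f c :=
  MonoidAlgebra.lift_of f c

end HCK

/-! ### Counit, coproduct and projection onto letters for quasi-shuffles. -/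

namespace Csh

variable (K : Type v) [Field K] {D : Type u}

local notation "ε" => CoalgebraStruct.counit (R := K) (A := Csh K D)
local notation "Δ" => CoalgebraStruct.comul (R := K) (A := Csh K D)

theorem consVec_single (a : D) : consVec K (MonoidAlgebra.single a 1) = cons K a := by
  change Finsupp.linearCombination K (fun a => cons K a) (Finsupp.single a 1) = _
  rw [Finsupp.linearCombination_single, one_smul]

theorem counit_word (w : List D) : ε (word K w) = if w.length = 0 then 1 else 0 :=
  linearLift_word K _ w

theorem comul_word (w : List D) : Δ (word K w) =
    ∑ i ∈ Finset.range (w.length + 1), word K (w.take i) ⊗ₜ[K] word K (w.drop i) :=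
  linearLift_word K _ w

theorem comul_nil : Δ (word K []) = word K [] ⊗ₜ[K] word K [] := by
  simp [comul_word]

theorem counit_nil : ε (word K []) = 1 := by
  simp [counit_word]

theorem toLetters_nil : toLetters K (word K ([] : List D)) = 0 :=
  linearLift_word K _ _

theorem counit_consVec (x : MonoidAlgebra K D) (y : Csh K D) : ε (consVec K x y) = 0 := by
  have : (consVec K).compr₂ ε = 0 := MonoidAlgebra.linearMap_ext_single fun a =>
    hom_ext fun w => by simp [consVec_single, counit_word]
  exact congrArg (fun f : MonoidAlgebra K D →ₗ[K] Csh K D →ₗ[K] K => f x y) this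

/-- Prefixing yields a one-letter word only from the empty word, whose coefficient in `y` is its
counit. -/
theorem toLetters_consVec (x : MonoidAlgebra K D) (y : Csh K D) :
    toLetters K (consVec K x y) = ε y • x := by
  have : (consVec K).compr₂ (toLetters K) =
      (LinearMap.lsmul K (MonoidAlgebra K D) ∘ₗ ε).flip := by
    refine MonoidAlgebra.linearMap_ext_single fun a => hom_ext fun w => ?_
    simp only [LinearMap.compr₂_apply, consVec_single, cons_word, toLetters, linearLift_word,
      LinearMap.flip_apply, LinearMap.comp_apply, counit_word, LinearMap.lsmul_apply]
    cases w <;> simp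
  exact congrArg (fun f : MonoidAlgebra K D →ₗ[K] Csh K D →ₗ[K] MonoidAlgebra K D => f x y) this

/-- The word is cut either before its first letter, which gives the first summand, or after it, and
then that letter stays in the left factor. -/
theorem comul_consVec (x : MonoidAlgebra K D) (y : Csh K D) :
    Δ (consVec K x y) = word K [] ⊗ₜ[K] consVec K x y + (consVec K x).rTensor (Csh K D) (Δ y) := by
  have : (consVec K).compr₂ Δ = (consVec K).compr₂ (TensorProduct.mk K _ _ (word K [])) +
      (LinearMap.lcomp K (Csh K D ⊗[K] Csh K D) Δ ∘ₗ
        LinearMap.rTensorHom (Csh K D)) ∘ₗ consVec K := by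
    refine MonoidAlgebra.linearMap_ext_single fun a => hom_ext fun w => ?_
    simp only [LinearMap.compr₂_apply, consVec_single, cons_word, LinearMap.add_apply,
      LinearMap.comp_apply, comul_word, LinearMap.lcomp_apply, LinearMap.coe_rTensorHom,
      map_sum, LinearMap.rTensor_tmul, TensorProduct.mk_apply, List.length_cons]
    rw [Finset.sum_range_succ', add_comm]
    simp
  exact congrArg (fun f : MonoidAlgebra K D →ₗ[K] Csh K D →ₗ[K] Csh K D ⊗[K] Csh K D => f x y) this

/-- Every element is recovered from its counit, and from the first letters and the remaining
words in its coproduct. -/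
theorem eq_counit_add (x : Csh K D) :
    x = ε x • word K [] + TensorProduct.lift (consVec K ∘ₗ toLetters K) (Δ x) := by
  have : LinearMap.id = (LinearMap.toSpanSingleton K (Csh K D) (word K [])) ∘ₗ ε +
      TensorProduct.lift (consVec K ∘ₗ toLetters K) ∘ₗ Δ := by
    refine hom_ext fun w => ?_
    simp only [LinearMap.add_apply, LinearMap.comp_apply, counit_word, comul_word, map_sum,
      TensorProduct.lift.tmul, LinearMap.id_apply, LinearMap.toSpanSingleton_apply]
    rcases w with _ | ⟨a, w⟩
    · simp [toLetters_nil]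
    -- Among all prefixes only the one of length one survives `toLetters`.
    · rw [Finset.sum_eq_single 1]
      · simp [toLetters, consVec_single]
      · intro i hi hi1
        rcases i with _ | _ | i
        · simp [toLetters_nil]
        · exact (hi1 rfl).elim
        · rcases w with _ | ⟨b, w⟩
          · simp at hi
          · simp [toLetters]
      · intro h
        simp at h
  exact congrArg (fun f : Csh K D →ₗ[K] Csh K D => f x) this

variable [CommSemigroup D]

theorem one_def : (1 : Csh K D) = word K [] := rfl

theorem consVec_mul_consVec (x y : MonoidAlgebra K D) (u v : Csh K D) :
    consVec K x u * consVec K y v = consVec K x (u * consVec K y v) +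
      consVec K y (consVec K x u * v) + consVec K (x * y) (u * v) := by
  induction x using MonoidAlgebra.induction_linear with
  | zero => simp
  | add x x' hx hx' =>
    simp only [map_add, LinearMap.add_apply, add_mul, hx, hx']
    abel
  | single a r =>
    induction y using MonoidAlgebra.induction_linear with
    | zero => simp
    | add y y' hy hy' =>
      simp only [map_add, LinearMap.add_apply, mul_add, hy, hy']
      abel
    | single b s =>
      have ha : (MonoidAlgebra.single a r : MonoidAlgebra K D) = r • MonoidAlgebra.single a 1 := by
        simp
      have hb : (MonoidAlgebra.single b s : MonoidAlgebra K D) = s • MonoidAlgebra.single b 1 := by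
        simp
      rw [ha, hb]
      simp only [map_smul, LinearMap.smul_apply, smul_mul_assoc, mul_smul_comm,
        MonoidAlgebra.single_mul_single, mul_one, consVec_single, ← smul_add, smul_comm r s]
      congr 2
      exact qsh_cons_cons K a b u v

theorem word_eq_nil_or_consVec (w : List D) :
    word K w = 1 ∨ ∃ (x : MonoidAlgebra K D) (u : Csh K D), word K w = consVec K x u := by
  rcases w with _ | ⟨a, w⟩
  · exact Or.inl rfl
  · exact Or.inr ⟨MonoidAlgebra.single a 1, word K w, by rw [consVec_single, cons_word]⟩

theorem counit_mul (x y : Csh K D) : ε (x * y) = ε x * ε y := by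
  have : (LinearMap.mul K (Csh K D)).compr₂ ε = (LinearMap.mul K K).compl₁₂ ε ε := by
    refine hom_ext fun u => hom_ext fun v => ?_
    simp only [LinearMap.compr₂_apply, LinearMap.compl₁₂_apply, LinearMap.mul_apply']
    rcases word_eq_nil_or_consVec K u with hu | ⟨a, u', hu⟩
    · rw [hu, one_mul, one_def, counit_nil, one_mul]
    · rcases word_eq_nil_or_consVec K v with hv | ⟨b, v', hv⟩
      · rw [hv, mul_one, one_def, counit_nil, mul_one]
      · rw [hu, hv, consVec_mul_consVec]
        simp only [map_add, counit_consVec, add_zero, mul_zero]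
  exact congrArg (fun f : Csh K D →ₗ[K] Csh K D →ₗ[K] K => f x y) this

/-- For nonempty words a single letter can come only from the bracket term of the quasi-shuffle.
Together with the terms in `ε`, this is the product rule of the unitization. -/
theorem toLetters_mul (x y : Csh K D) : toLetters K (x * y) =
    ε x • toLetters K y + ε y • toLetters K x + toLetters K x * toLetters K y := by
  have : (LinearMap.mul K (Csh K D)).compr₂ (toLetters K) =
      (LinearMap.lsmul K (MonoidAlgebra K D)).compl₁₂ ε (toLetters K) +
      ((LinearMap.lsmul K (MonoidAlgebra K D)).compl₁₂ ε (toLetters K)).flip +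
      (LinearMap.mul K (MonoidAlgebra K D)).compl₁₂ (toLetters K) (toLetters K) := by
    refine hom_ext fun u => hom_ext fun v => ?_
    simp only [LinearMap.compr₂_apply, LinearMap.compl₁₂_apply, LinearMap.mul_apply',
      LinearMap.add_apply, LinearMap.flip_apply, LinearMap.lsmul_apply]
    rcases word_eq_nil_or_consVec K u with hu | ⟨a, u', hu⟩
    · rw [hu, one_mul, one_def, counit_nil, toLetters_nil]
      simp
    · rcases word_eq_nil_or_consVec K v with hv | ⟨b, v', hv⟩
      · rw [hv, mul_one, one_def, counit_nil, toLetters_nil]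
        simp
      · rw [hu, hv, consVec_mul_consVec]
        simp only [map_add, toLetters_consVec, counit_consVec, counit_mul, zero_smul, zero_add,
          mul_zero, zero_mul, smul_mul_assoc, mul_smul_comm, smul_smul]
        rw [mul_comm]
  exact congrArg (fun f : Csh K D →ₗ[K] Csh K D →ₗ[K] MonoidAlgebra K D => f x y) this

/-- The counit and the projection onto the letters, together. -/
def augLetters : Csh K D →* Unitization K (MonoidAlgebra K D) where
  toFun x := Unitization.inl (ε x) + Unitization.inr (toLetters K x)
  map_one' := by
    rw [one_def, counit_nil, toLetters_nil, Unitization.inr_zero, add_zero, Unitization.inl_one]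
  map_mul' x y := by
    rw [counit_mul, toLetters_mul]
    ext <;> simp

theorem fst_augLetters (x : Csh K D) : (augLetters K x).fst = ε x := by
  simp [augLetters]

theorem snd_augLetters (x : Csh K D) : (augLetters K x).snd = toLetters K x := by
  simp [augLetters]

end Csh

/-! ### The morphism as a sum over flags of upsets, and its uniqueness. -/

namespace ForestClass

variable {K : Type v} [Field K] {D : Type u} [CommSemigroup D]
  (φ : (TreeClass D →₀ K) →ₗ[K] MonoidAlgebra K D)

/-- The multiplicative extension of `φ` to forests, after adjoining a unit to `K(D)`. -/
def aug : ForestClass D →* Unitization K (MonoidAlgebra K D) :=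
  treeLift fun t => Unitization.inr (φ (Finsupp.single t 1))

/-- The bracket-product of the values of `φ` at the components of a forest. -/
def bracket (c : ForestClass D) : MonoidAlgebra K D := (aug φ c).snd

-- The empty product is the adjoined unit, which has no component in `K(D)`. Hence the empty upset
-- contributes nothing to the recursions below, and these descend to strictly smaller forests.
@[simp] theorem bracket_one : bracket φ 1 = 0 := by
  rw [bracket, map_one, Unitization.snd_one]

theorem bracket_tree (t : TreeClass D) : bracket φ t.1 = φ (Finsupp.single t 1) := by
  rw [bracket, aug, treeLift_tree, Unitization.snd_inr]

open Classical in
theorem fst_aug (c : ForestClass D) : (aug φ c).fst = if c = 1 then 1 else 0 := by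
  split_ifs with h
  · rw [h, map_one, Unitization.fst_one]
  · obtain ⟨F, rfl⟩ := exists_mk c
    rw [mk_eq_one_iff, not_isEmpty_iff] at h
    obtain ⟨v⟩ := h
    obtain ⟨r, -, hr⟩ := F.exists_root v
    rw [aug, treeLift_mk]
    refine (map_prod (Unitization.fstHom K (MonoidAlgebra K D)) _ _).trans ?_
    exact Finset.prod_eq_zero (Finset.mem_univ (⟨r, hr⟩ : F.Component)) rfl

open Classical in
-- The product rule of the unitization. The three terms are those of the quasi-shuffle recursion: a
-- first letter taken from one factor, from the other, or from both.
theorem bracket_mul (c d : ForestClass D) : bracket φ (c * d) =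
    (if c = 1 then bracket φ d else 0) + (if d = 1 then bracket φ c else 0) +
      bracket φ c * bracket φ d := by
  rw [bracket, map_mul, Unitization.snd_mul, fst_aug, fst_aug]
  simp only [ite_smul, one_smul, zero_smul]
  rfl

open Classical in
/-- The sum over the flags of `q` upsets of a forest of the words of bracket-products. -/
def layer : ℕ → ForestClass D → Csh K D
  | 0, c => if c = 1 then 1 else 0
  | q + 1, c => upSum c fun a b => Csh.consVec K (bracket φ a) (layer q b)

theorem layer_succ (q : ℕ) (c : ForestClass D) :
    layer φ (q + 1) c = upSum c fun a b => Csh.consVec K (bracket φ a) (layer φ q b) := rfl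

/-- Each nonzero letter uses up at least one vertex. -/
theorem layer_eq_zero {q : ℕ} {c : ForestClass D} (h : c.card < q) : layer φ q c = 0 := by
  induction q generalizing c with
  | zero => omega
  | succ q ih =>
    rw [layer_succ, ← upSum_zero c]
    refine upSum_congr fun a b hab => ?_
    by_cases ha : a = 1
    · rw [ha, bracket_one, map_zero, LinearMap.zero_apply]
    · rw [← card_eq_zero_iff] at ha
      rw [ih (by omega), map_zero]

/-- The sum over all the flags of upsets of the words of bracket-products. -/
def flagSum (c : ForestClass D) : Csh K D := ∑ q ∈ Finset.range (c.card + 1), layer φ q c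

theorem flagSum_eq {c : ForestClass D} {n : ℕ} (h : c.card < n) :
    flagSum φ c = ∑ q ∈ Finset.range n, layer φ q c := by
  refine Finset.sum_subset (Finset.range_subset_range.2 h) fun q _ hq => layer_eq_zero φ ?_
  simp only [Finset.mem_range] at hq
  omega

open Classical in
theorem flagSum_rec (c : ForestClass D) : flagSum φ c =
    (if c = 1 then 1 else 0) + upSum c fun a b => Csh.consVec K (bracket φ a) (flagSum φ b) := by
  -- The bound is two above the number of vertices, so that `c.card + 1` layers remain once layer
  -- `0` is split off; this is enough for every `b`, including `b = c`.
  rw [flagSum_eq φ (Nat.lt_add_of_pos_right (n := c.card) (k := 2) two_pos),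
    Finset.sum_range_succ', add_comm]
  congr 1
  simp only [layer_succ]
  rw [← upSum_sum]
  refine upSum_congr fun a b hab => ?_
  rw [flagSum_eq φ (n := c.card + 1) (by omega), map_sum]

open Classical in
-- The recursion has only one solution: the summand with `a = 1` vanishes, and in all the others `b`
-- has fewer vertices than `c`.
theorem eq_flagSum {f : ForestClass D → Csh K D} (h : ∀ c, f c =
    (if c = 1 then 1 else 0) + upSum c fun a b => Csh.consVec K (bracket φ a) (f b))
    (c : ForestClass D) : f c = flagSum φ c := by
  induction hn : c.card using Nat.strong_induction_on generalizing c with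
  | _ n ih =>
    rw [h, flagSum_rec]
    congr 1
    refine upSum_congr fun a b hab => ?_
    by_cases ha : a = 1
    · simp [ha]
    · rw [← card_eq_zero_iff] at ha
      rw [ih _ (by omega) b rfl]

theorem flagSum_one : flagSum φ 1 = 1 := by
  simp [flagSum, layer]

theorem flagSum_of_ne_one {c : ForestClass D} (h : c ≠ 1) :
    flagSum φ c = upSum c fun a b => Csh.consVec K (bracket φ a) (flagSum φ b) := by
  rw [flagSum_rec, if_neg h, zero_add]

/-- Induction on the total number of vertices: both sides expand into double sums over upsets of `c`
and `d`, and their three kinds of terms agree. -/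
theorem flagSum_mul (c d : ForestClass D) : flagSum φ (c * d) = flagSum φ c * flagSum φ d := by
  classical
  induction hn : (c * d).card using Nat.strong_induction_on generalizing c d with
  | _ n ih =>
    by_cases hc : c = 1
    · rw [hc, one_mul, flagSum_one, one_mul]
    by_cases hd : d = 1
    · rw [hd, mul_one, flagSum_one, mul_one]
    rw [card_mul] at hn
    have hc' := flagSum_of_ne_one φ hc
    have hd' := flagSum_of_ne_one φ hd
    have e : flagSum φ c * flagSum φ d = upSum c fun a b => upSum d fun a' b' =>
        Csh.consVec K (bracket φ a) (flagSum φ b) * Csh.consVec K (bracket φ a') (flagSum φ b') := by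
      rw [hc', hd', ← AddMonoidHom.mulRight_apply, map_upSum]
      congr 1
      funext a b
      rw [AddMonoidHom.mulRight_apply, ← AddMonoidHom.coe_mulLeft, map_upSum]
    rw [e]
    simp only [Csh.consVec_mul_consVec, upSum_add]
    rw [flagSum_of_ne_one φ fun h => hc (mul_eq_one_iff.1 h).1, upSum_mul]
    simp only [bracket_mul, map_add, LinearMap.add_apply, upSum_add]
    congr 1
    -- The terms with `a' = 1` leave `d` whole and match the quasi-shuffles that begin with a letter
    -- from `c`; those with `a = 1` are symmetric. In each case the inner sum collapses, and the
    -- recursion for the untouched factor restores its `flagSum`.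
    · rw [add_comm]
      congr 1
      · refine upSum_congr fun a b hab => ?_
        have : ∀ a' b' : ForestClass D, Csh.consVec K (if a' = 1 then bracket φ a else 0) (flagSum φ (b * b')) =
            if a' = 1 then Csh.consVec K (bracket φ a) (flagSum φ (b * b')) else 0 := by
          intro a' b'
          split_ifs <;> simp
        simp only [this]
        rw [upSum_ite_left d fun _ b' => Csh.consVec K (bracket φ a) (flagSum φ (b * b')),
          ← map_upSum, ← AddMonoidHom.coe_mulLeft, ← map_upSum, ← hd', AddMonoidHom.coe_mulLeft]
        by_cases ha : a = 1
        · simp [ha]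
        · rw [← card_eq_zero_iff] at ha
          rw [ih _ _ _ _ rfl]
          rw [card_mul]; omega
      · rw [upSum_comm, upSum_comm c d]
        refine upSum_congr fun a b hab => ?_
        have : ∀ a' b' : ForestClass D, Csh.consVec K (if a' = 1 then bracket φ a else 0) (flagSum φ (b' * b)) =
            if a' = 1 then Csh.consVec K (bracket φ a) (flagSum φ (b' * b)) else 0 := by
          intro a' b'
          split_ifs <;> simp
        simp only [this]
        rw [upSum_ite_left c fun _ b' => Csh.consVec K (bracket φ a) (flagSum φ (b' * b)),
          ← map_upSum]
        have : ∀ a' b', Csh.consVec K (bracket φ a') (flagSum φ b') * flagSum φ b =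
          AddMonoidHom.mulRight (flagSum φ b) (Csh.consVec K (bracket φ a') (flagSum φ b')) :=
          fun _ _ => rfl
        simp only [this]
        rw [← map_upSum, ← hc', AddMonoidHom.coe_mulRight]
        by_cases ha : a = 1
        · simp [ha]
        · rw [← card_eq_zero_iff] at ha
          rw [ih _ _ _ _ rfl]
          rw [card_mul]; omega
    · refine upSum_congr fun a b hab => upSum_congr fun a' b' hab' => ?_
      by_cases ha : a = 1
      · simp [ha]
      · rw [← card_eq_zero_iff] at ha
        rw [ih _ _ _ _ rfl]
        rw [card_mul]; omega

open Classical in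
theorem counit_flagSum (c : ForestClass D) :
    CoalgebraStruct.counit (R := K) (flagSum φ c) = if c = 1 then 1 else 0 := by
  rw [flagSum_rec, map_add, map_upSum]
  simp only [Csh.counit_consVec, upSum_zero, add_zero]
  split_ifs
  · exact Csh.counit_nil K
  · exact map_zero _

/-- Only the flag whose single upset is the whole forest yields a one-letter word. -/
theorem toLetters_flagSum (c : ForestClass D) : Csh.toLetters K (flagSum φ c) = bracket φ c := by
  classical
  rw [flagSum_rec, map_add, map_upSum]
  simp only [Csh.toLetters_consVec, counit_flagSum, ite_smul, one_smul, zero_smul]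
  rw [upSum_ite_right c fun a _ => bracket φ a]
  split_ifs
  · rw [Csh.one_def, Csh.toLetters_nil, zero_add]
  · rw [map_zero, zero_add]

/-- Deconcatenating after the first letter means removing a top upset and then splitting what
remains. By `upSum_coassoc` this is the same as splitting first and then removing a top upset from
the upper part. -/
theorem comul_flagSum (c : ForestClass D) : CoalgebraStruct.comul (R := K) (flagSum φ c) =
    upSum c fun a b => flagSum φ a ⊗ₜ[K] flagSum φ b := by
  classical
  induction hn : c.card using Nat.strong_induction_on generalizing c with
  | _ n ih =>
    by_cases hc : c = 1
    · rw [hc, upSum_one, flagSum_one, Csh.one_def, Csh.comul_nil]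
    have e1 : ∀ a b, flagSum φ a ⊗ₜ[K] flagSum φ b =
        (if a = 1 then 1 ⊗ₜ[K] flagSum φ b else 0) + upSum a fun a' a'' =>
          (Csh.consVec K (bracket φ a')).rTensor (Csh K D) (flagSum φ a'' ⊗ₜ[K] flagSum φ b) := by
      intro a b
      rw [flagSum_rec φ a, TensorProduct.add_tmul, TensorProduct.ite_tmul]
      congr 1
      exact map_upSum ((TensorProduct.mk K (Csh K D) (Csh K D)).flip (flagSum φ b)) _ _
    rw [show (fun a b => flagSum φ a ⊗ₜ[K] flagSum φ b) = _ from
      funext fun a => funext fun b => e1 a b]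
    rw [upSum_add]
    rw [upSum_ite_left c fun _ b => (1 : Csh K D) ⊗ₜ[K] flagSum φ b,
      ← upSum_coassoc c fun a a' b => (Csh.consVec K (bracket φ a)).rTensor (Csh K D)
        (flagSum φ a' ⊗ₜ[K] flagSum φ b)]
    rw [flagSum_of_ne_one φ hc, map_upSum]
    simp only [Csh.comul_consVec, upSum_add]
    congr 1
    · exact (map_upSum (TensorProduct.mk K (Csh K D) (Csh K D) 1) _ _).symm
    · refine upSum_congr fun a b hab => ?_
      rw [← map_upSum]
      by_cases ha : a = 1
      · simp [ha]
      · rw [← card_eq_zero_iff] at ha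
        rw [ih _ (by omega) b rfl]

/-- `flagSum` as a morphism of bialgebras. -/
def flagHom : HCK K D →ₐc[K] Csh K D :=
  let f : HCK K D →ₐ[K] Csh K D := HCK.algLift K
    { toFun := flagSum φ, map_one' := flagSum_one φ, map_mul' := flagSum_mul φ }
  have hf : ∀ c, f (HCK.of K c) = flagSum φ c := fun c => HCK.algLift_of K _ c
  { f with
    map_smul' := map_smul f
    counit_comp := by
      refine HCK.hom_ext fun c => ?_
      change CoalgebraStruct.counit (f (HCK.of K c)) = _
      rw [hf, counit_flagSum, HCK.counit_of]
    map_comp_comul := by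
      refine HCK.hom_ext fun c => ?_
      change TensorProduct.map f.toLinearMap f.toLinearMap (CoalgebraStruct.comul (HCK.of K c)) =
        CoalgebraStruct.comul (f (HCK.of K c))
      rw [hf, comul_flagSum, HCK.comul_of, map_upSum]
      simp only [TensorProduct.map_tmul, AlgHom.toLinearMap_apply, hf] }

theorem flagHom_of (c : ForestClass D) : flagHom φ (HCK.of K c) = flagSum φ c :=
  HCK.algLift_of K _ c

theorem lifts_flagHom : Lifts φ (flagHom φ) := by
  intro x
  have : Csh.toLetters K ∘ₗ (flagHom φ : HCK K D →ₗ[K] Csh K D) ∘ₗ HCK.ofTrees K = φ := by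
    refine Finsupp.lhom_ext' fun t => LinearMap.ext_ring ?_
    change Csh.toLetters K (flagHom φ (HCK.ofTrees K (Finsupp.single t 1))) =
      φ (Finsupp.single t 1)
    rw [HCK.ofTrees_single, flagHom_of, toLetters_flagSum, bracket_tree]
  exact congrArg (fun f : (TreeClass D →₀ K) →ₗ[K] MonoidAlgebra K D => f x) this

theorem apply_of_of_lifts {Φ : HCK K D →ₐc[K] Csh K D} (h : Lifts φ Φ) (c : ForestClass D) :
    Φ (HCK.of K c) = flagSum φ c := by
  classical
  have hcounit : ∀ x, CoalgebraStruct.counit (R := K) (Φ x) = CoalgebraStruct.counit (R := K) x :=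
    fun x => congrArg (fun f : HCK K D →ₗ[K] K => f x) Φ.counit_comp
  have hcomul : ∀ x, TensorProduct.map (Φ : HCK K D →ₗ[K] Csh K D) (Φ : HCK K D →ₗ[K] Csh K D)
      (CoalgebraStruct.comul x) = CoalgebraStruct.comul (R := K) (Φ x) :=
    fun x => congrArg (fun f : HCK K D →ₗ[K] Csh K D ⊗[K] Csh K D => f x) Φ.map_comp_comul
  -- Both sides are monoid morphisms into the unitization, so the lifting condition on trees forces
  -- the values of `π ∘ Φ` on all forests.
  have haug : (Csh.augLetters K).comp ((Φ : HCK K D →* Csh K D).comp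
      (MonoidAlgebra.of K (ForestClass D))) = aug φ := by
    refine hom_ext_tree fun t => ?_
    change Csh.augLetters K (Φ (HCK.of K t.1)) = _
    have h1 : t.1 ≠ 1 := by
      obtain ⟨c, hc⟩ := t
      obtain ⟨F, rfl⟩ := exists_mk c
      rintro h1
      exact (mk_eq_one_iff.1 h1).false hc.choose
    have h2 := h (Finsupp.single t 1)
    rw [HCK.ofTrees_single] at h2
    ext
    · rw [Csh.fst_augLetters, hcounit, HCK.counit_of, fst_aug]
    · rw [Csh.snd_augLetters, h2, aug, treeLift_tree, Unitization.snd_inr]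
  have hletters : ∀ c, Csh.toLetters K (Φ (HCK.of K c)) = bracket φ c := by
    intro c
    rw [bracket, ← haug, ← Csh.snd_augLetters]
    rfl
  refine eq_flagSum φ (f := fun c => Φ (HCK.of K c)) (fun c => ?_) c
  rw [Csh.eq_counit_add K (Φ (HCK.of K c)), hcounit, HCK.counit_of, ← hcomul, HCK.comul_of,
    map_upSum, map_upSum, ite_smul, one_smul, zero_smul]
  congr 1
  refine upSum_congr fun a b _ => ?_
  rw [TensorProduct.map_tmul, TensorProduct.lift.tmul, LinearMap.comp_apply]
  exact congrArg (fun x => Csh.consVec K x (Φ (HCK.of K b))) (hletters a)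

theorem eq_flagHom_of_lifts {Φ : HCK K D →ₐc[K] Csh K D} (h : Lifts φ Φ) : Φ = flagHom φ := by
  have : (Φ : HCK K D →ₗ[K] Csh K D) = (flagHom φ : HCK K D →ₗ[K] Csh K D) :=
    HCK.hom_ext fun c => (apply_of_of_lifts φ h c).trans (flagHom_of φ c).symm
  exact DFunLike.ext _ _ fun x => congrArg (fun f : HCK K D →ₗ[K] Csh K D => f x) this

end ForestClass

/-! ### Flags of upsets as monotone maps. -/

namespace RootedForest

variable {F : RootedForest}

open Classical in
/-- The maps to `{0, …, q - 1}` that are weakly increasing along the edges. -/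
def monotoneMaps (F : RootedForest) (q : ℕ) : Finset (F.V → Fin q) :=
  Finset.univ.filter fun τ => ∀ a b, F.parent a = some b → τ a ≤ τ b

@[simp] theorem mem_monotoneMaps {q : ℕ} {τ : F.V → Fin q} :
    τ ∈ F.monotoneMaps q ↔ ∀ a b, F.parent a = some b → τ a ≤ τ b := by
  simp [monotoneMaps]

end RootedForest

section ExtendByZero

variable {V : Type*} {q : ℕ} (U : Finset V) (τ : {v // v ∉ U} → Fin q)

open Classical in
/-- Shift a map defined outside of `U` by one, and extend it by `0` on `U`. -/
def extendByZero (v : V) : Fin (q + 1) := if h : v ∈ U then 0 else (τ ⟨v, h⟩).succ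

variable {U}

theorem extendByZero_of_mem {v : V} (h : v ∈ U) : extendByZero U τ v = 0 := dif_pos h

theorem extendByZero_of_notMem {v : V} (h : v ∉ U) :
    extendByZero U τ v = (τ ⟨v, h⟩).succ := dif_neg h

theorem extendByZero_eq_zero_iff {v : V} : extendByZero U τ v = 0 ↔ v ∈ U := by
  by_cases h : v ∈ U
  · simp [extendByZero_of_mem τ h, h]
  · simp [extendByZero_of_notMem τ h, h]

theorem extendByZero_eq_succ_iff {v : V} {i : Fin q} :
    extendByZero U τ v = i.succ ↔ ∃ h : v ∉ U, τ ⟨v, h⟩ = i := by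
  by_cases h : v ∈ U
  · simp [extendByZero_of_mem τ h, h, eq_comm]
  · simp [extendByZero_of_notMem τ h, h]

end ExtendByZero

namespace Csh

variable {K : Type v} [Field K] {D : Type u}

theorem wordOfVec_eq_zero {l : List (MonoidAlgebra K D)} (h : 0 ∈ l) : wordOfVec K l = 0 := by
  induction l with
  | nil => simp at h
  | cons x l ih =>
    rw [wordOfVec]
    rcases List.mem_cons.1 h with h | h
    · rw [← h, map_zero, LinearMap.zero_apply]
    · rw [ih h, map_zero]

end Csh

namespace ForestClass

variable {K : Type v} [Field K] {D : Type u} [CommSemigroup D]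
  (φ : (TreeClass D →₀ K) →ₗ[K] MonoidAlgebra K D)

/-- The word of the bracket-products of the fibres of a map. -/
def fiberWord (F : DecForest D) {q : ℕ} (τ : F.V → Fin q) : Csh K D :=
  Csh.wordOfVec K (List.ofFn fun i => bracket φ (mk (F.induce fun v => τ v = i)))

theorem fiberWord_extendByZero (F : DecForest D) {q : ℕ} (U : Finset F.V)
    (τ : (F.induce (· ∉ U)).V → Fin q) : fiberWord φ F (extendByZero U τ) =
      Csh.consVec K (bracket φ (mk (F.induce (· ∈ U)))) (fiberWord φ (F.induce (· ∉ U)) τ) := by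
  have h0 : mk (F.induce fun v => extendByZero U τ v = 0) = mk (F.induce (· ∈ U)) :=
    F.mk_induce_congr fun v => extendByZero_eq_zero_iff τ
  have h1 : ∀ i : Fin q, mk (F.induce fun v => extendByZero U τ v = i.succ) =
      mk ((F.induce (· ∉ U)).induce fun v => τ v = i) := fun i =>
    (F.mk_induce_induce fun v => extendByZero_eq_succ_iff τ).symm
  rw [fiberWord, fiberWord, List.ofFn_succ, Csh.wordOfVec, h0]
  simp only [h1]

theorem layer_zero_mk (F : DecForest D) :
    layer φ 0 (mk F) = ∑ τ ∈ F.monotoneMaps 0, fiberWord φ F τ := by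
  rw [layer]
  split_ifs with h
  · rw [mk_eq_one_iff] at h
    rw [Finset.sum_eq_single (h.elim)]
    · rfl
    · intro τ _ hτ
      exact (hτ (funext fun x => h.elim x)).elim
    · intro h'
      exact (h' (RootedForest.mem_monotoneMaps.2 fun a => h.elim a)).elim
  · rw [mk_eq_one_iff, not_isEmpty_iff] at h
    obtain ⟨v⟩ := h
    exact (Finset.sum_eq_zero fun τ _ => (τ v).elim0).symm

/-- A flag is encoded by the level of each vertex: the fibre of `0` is the first upset, and the
levels on its complement are shifted down by one. Closure under children says that levels weakly
increase towards the roots. -/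
theorem layer_mk (q : ℕ) (F : DecForest D) :
    layer φ q (mk F) = ∑ τ ∈ F.monotoneMaps q, fiberWord φ F τ := by
  classical
  induction q generalizing F with
  | zero => exact layer_zero_mk φ F
  | succ q ih =>
    rw [layer_succ, upSum_mk]
    simp only [ih, map_sum]
    rw [Finset.sum_sigma']
    refine Finset.sum_bij (fun x _ => extendByZero x.1 x.2) ?_ ?_ ?_ ?_
    · rintro ⟨U, τ⟩ h
      rw [Finset.mem_sigma, RootedForest.mem_upsets, RootedForest.mem_monotoneMaps] at h
      rw [RootedForest.mem_monotoneMaps]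
      intro a b hab
      dsimp only
      by_cases ha : a ∈ U
      · rw [extendByZero_of_mem τ ha]
        exact Fin.zero_le _
      · have hb : b ∉ U := fun hb => ha (h.1 a b hab hb)
        rw [extendByZero_of_notMem τ ha, extendByZero_of_notMem τ hb, Fin.succ_le_succ_iff]
        exact h.2 ⟨a, ha⟩ ⟨b, hb⟩ (F.toRootedForest.induce_parent_eq_some.2 hab)
    · rintro ⟨U, τ⟩ _ ⟨U', τ'⟩ _ h
      dsimp only at h τ τ'
      obtain rfl : U = U' := by
        ext v
        rw [← extendByZero_eq_zero_iff τ, h, extendByZero_eq_zero_iff τ']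
      congr 1
      funext ⟨v, hv⟩
      have := congrFun h v
      rw [extendByZero_of_notMem τ hv, extendByZero_of_notMem τ' hv] at this
      exact Fin.succ_injective _ this
    · intro τ hτ
      rw [RootedForest.mem_monotoneMaps] at hτ
      refine ⟨⟨Finset.univ.filter fun v => τ v = 0, fun v => (τ v.1).pred fun h =>
        v.2 (Finset.mem_filter.2 ⟨Finset.mem_univ _, h⟩)⟩, ?_, ?_⟩
      · rw [Finset.mem_sigma, RootedForest.mem_upsets, RootedForest.mem_monotoneMaps]
        constructor
        · intro a b hab hb
          rw [Finset.mem_filter_univ] at hb ⊢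
          exact Fin.le_zero_iff.1 (hb ▸ hτ a b hab)
        · intro a b hab
          rw [Fin.pred_le_pred_iff]
          exact hτ _ _ (F.toRootedForest.induce_parent_eq_some.1 hab)
      · funext v
        by_cases h : τ v = 0
        · rw [h, extendByZero_eq_zero_iff, Finset.mem_filter_univ, h]
        · rw [extendByZero_of_notMem _ (by rwa [Finset.mem_filter_univ]), Fin.succ_pred]
    · rintro ⟨U, τ⟩ _
      exact (fiberWord_extendByZero φ F U τ).symm

/-- A missed value is an empty fibre, hence a zero letter, and the word is multilinear in its
letters. -/
theorem fiberWord_eq_zero {F : DecForest D} {q : ℕ} {τ : F.V → Fin q}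
    (h : ¬ Function.Surjective τ) : fiberWord φ F τ = 0 := by
  simp only [Function.Surjective, not_forall, not_exists] at h
  obtain ⟨i, hi⟩ := h
  refine Csh.wordOfVec_eq_zero ((List.mem_ofFn' _ _).2 ⟨i, ?_⟩)
  have : mk (F.induce fun v => τ v = i) = 1 := mk_eq_one_iff.2 (isEmpty_subtype _ |>.2 hi)
  dsimp only
  rw [this, bracket_one]

end ForestClass

/-! ### Monotone maps and linear preorders on contractions. -/

namespace RootedForest

variable {F : RootedForest}

theorem rootOf_of_parent_eq_none {r : F.V} (h : F.parent r = none) : F.rootOf r = r :=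
  F.root_unique (F.reach_rootOf r) (F.parent_rootOf r) Relation.ReflTransGen.refl h

theorem rootOf_eq_of_reach {a b : F.V} (h : F.Reach a b) : F.rootOf a = F.rootOf b :=
  F.root_unique (F.reach_rootOf a) (F.parent_rootOf a) (h.trans (F.reach_rootOf b))
    (F.parent_rootOf b)

theorem part_parent_eq_some {e : Finset F.V} {a b : F.V} :
    (F.part e).parent a = some b ↔ a ∈ e ∧ F.parent a = some b := by
  simp only []
  split_ifs with h <;> simp [h]

/-- The vertex of `Cont_e(F)` to which a vertex of `F` is contracted. -/
def contMap (F : RootedForest) (e : Finset F.V) (v : F.V) : (F.cont e).V :=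
  ⟨(F.part e).rootOf v, (F.part e).parent_rootOf v⟩

theorem contMap_coe (e : Finset F.V) (r : (F.cont e).V) : F.contMap e r.1 = r :=
  Subtype.ext (rootOf_of_parent_eq_none r.2)

theorem contMap_eq_of_reach {e : Finset F.V} {a b : F.V} (h : (F.part e).Reach a b) :
    F.contMap e a = F.contMap e b :=
  Subtype.ext (rootOf_eq_of_reach h)

theorem cont_parent_eq_some {e : Finset F.V} {a b : (F.cont e).V} :
    (F.cont e).parent a = some b ↔ ∃ u, F.parent a.1 = some u ∧ F.contMap e u = b :=
  Option.map_eq_some_iff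

variable {q : ℕ}

/-- A contracted edge has both ends in one component, while an uncontracted one becomes an edge of
the contraction, along which `σ` is strict. So `e` can be read off from the pullback of `σ` to the
vertices. -/
theorem IsLinearPreorder.mem_iff {e : Finset F.V} {σ : (F.cont e).V → Fin q}
    (hσ : (F.cont e).IsLinearPreorder σ) {a b : F.V} (hab : F.parent a = some b) :
    a ∈ e ↔ σ (F.contMap e a) = σ (F.contMap e b) := by
  constructor
  · intro ha
    rw [contMap_eq_of_reach (Relation.ReflTransGen.single (part_parent_eq_some.2 ⟨ha, hab⟩))]
  · intro h
    by_contra ha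
    have hr : (F.part e).parent a = none := by
      simp only [if_neg ha]
    have h1 : F.contMap e a = ⟨a, hr⟩ := contMap_coe e ⟨a, hr⟩
    refine (hσ.2 ⟨a, hr⟩ (F.contMap e b) ?_ ?_).ne' (h1 ▸ h)
    -- If both ends lay in one component, its root would be `a`, and the path from `b` to `a` would
    -- close a cycle.
    · intro h'
      refine F.acyclic a (Relation.TransGen.head' hab ?_)
      have := F.reach_of_part ((F.part e).reach_rootOf b)
      rwa [show (F.part e).rootOf b = a from (congrArg Subtype.val h').symm] at this
    · exact Relation.ReflTransGen.single (cont_parent_eq_some.2 ⟨b, hab, rfl⟩)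

theorem IsLinearPreorder.le_of_parent {e : Finset F.V} {σ : (F.cont e).V → Fin q}
    (hσ : (F.cont e).IsLinearPreorder σ) {a b : F.V} (hab : F.parent a = some b) :
    σ (F.contMap e b) ≤ σ (F.contMap e a) := by
  by_cases ha : a ∈ e
  · exact ((hσ.mem_iff hab).1 ha).ge
  · have hr : (F.part e).parent a = none := by
      simp only [if_neg ha]
    have h1 : F.contMap e a = ⟨a, hr⟩ := contMap_coe e ⟨a, hr⟩
    by_cases h : F.contMap e a = F.contMap e b
    · rw [h]
    · refine (hσ.2 _ _ h ?_).le
      rw [h1]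
      exact Relation.ReflTransGen.single (cont_parent_eq_some.2 ⟨b, hab, rfl⟩)

open Classical in
/-- The edges along which a map is constant. -/
def constEdges (τ : F.V → Fin q) : Finset F.V :=
  Finset.univ.filter fun v => ∃ u, F.parent v = some u ∧ τ v = τ u

theorem mem_constEdges {τ : F.V → Fin q} {v : F.V} :
    v ∈ constEdges τ ↔ ∃ u, F.parent v = some u ∧ τ v = τ u := by
  simp [constEdges]

theorem constEdges_subset (τ : F.V → Fin q) : constEdges τ ⊆ F.edges := by
  intro v hv
  obtain ⟨u, hu, -⟩ := mem_constEdges.1 hv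
  simp [edges, hu]

theorem eq_of_part_constEdges_reach {τ : F.V → Fin q} {a b : F.V}
    (h : (F.part (constEdges τ)).Reach a b) : τ a = τ b := by
  induction h with
  | refl => rfl
  | tail _ h ih =>
    obtain ⟨h1, h2⟩ := part_parent_eq_some.1 h
    obtain ⟨u, hu, hu'⟩ := mem_constEdges.1 h1
    rw [ih, hu', Option.some.inj (hu.symm.trans h2)]

/-- Gives injectivity of `(e, σ) ↦ τ`. The hypothesis `e ⊆ F.edges` excludes roots, which could be
added to `e` without changing `F.part e`. -/
theorem IsLinearPreorder.eq_constEdges {e : Finset F.V} (he : e ⊆ F.edges)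
    {σ : (F.cont e).V → Fin q} (hσ : (F.cont e).IsLinearPreorder σ) :
    constEdges (fun v => (σ (F.contMap e v)).rev) = e := by
  ext v
  rw [mem_constEdges]
  constructor
  · rintro ⟨u, hu, h⟩
    exact (hσ.mem_iff hu).2 (Fin.rev_injective h)
  · intro hv
    have := he hv
    simp only [edges, Finset.mem_filter, Finset.mem_univ, true_and, Ne,
      Option.eq_none_iff_forall_ne_some, not_forall, not_not] at this
    obtain ⟨u, hu⟩ := this
    exact ⟨u, hu, congrArg Fin.rev ((hσ.mem_iff hu).1 hv)⟩

/-- Gives surjectivity of `(e, σ) ↦ τ`: along an edge that is not contracted `τ` is monotone and not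
constant, hence strict, and this propagates along paths of the contraction. -/
theorem isLinearPreorder_constEdges {τ : F.V → Fin q}
    (hτ : ∀ a b, F.parent a = some b → τ a ≤ τ b) (hs : Function.Surjective τ) :
    (F.cont (constEdges τ)).IsLinearPreorder fun r => (τ r.1).rev := by
  refine ⟨fun i => ?_, fun a b hne hab => ?_⟩
  · obtain ⟨v, hv⟩ := hs i.rev
    refine ⟨F.contMap _ v, ?_⟩
    change (τ ((F.part (constEdges τ)).rootOf v)).rev = i
    rw [← eq_of_part_constEdges_reach ((F.part (constEdges τ)).reach_rootOf v), hv, Fin.rev_rev]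
  · dsimp only
    rw [Fin.rev_lt_rev]
    have hab' : Relation.TransGen (F.cont (constEdges τ)).Step a b :=
      (Relation.reflTransGen_iff_eq_or_transGen.1 hab).resolve_left hne.symm
    have one : ∀ a b, (F.cont (constEdges τ)).Step a b → τ a.1 < τ b.1 := by
      intro a b h
      obtain ⟨u, hu, rfl⟩ := cont_parent_eq_some.1 h
      have h1 : τ u = τ ((F.part (constEdges τ)).rootOf u) :=
        eq_of_part_constEdges_reach ((F.part (constEdges τ)).reach_rootOf u)
      change τ a.1 < τ ((F.part (constEdges τ)).rootOf u)
      rw [← h1]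
      refine lt_of_le_of_ne (hτ _ _ hu) fun h2 => ?_
      have h3 := part_parent_eq_some.2 ⟨mem_constEdges.2 ⟨u, hu, h2⟩, hu⟩
      exact Option.some_ne_none _ (h3.symm.trans a.2)
    clear hab hne
    induction hab' with
    | single h => exact one _ _ h
    | tail _ h ih => exact ih.trans (one _ _ h)

theorem linearPreorders_eq_empty (h : Fintype.card F.V < q) : F.linearPreorders q = ∅ := by
  refine Finset.eq_empty_of_forall_notMem fun σ hσ => ?_
  simp only [linearPreorders, Finset.mem_filter, Finset.mem_univ, true_and] at hσ
  have := Fintype.card_le_of_surjective σ hσ.1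
  rw [Fintype.card_fin] at this
  omega

theorem card_cont_le (F : RootedForest) (e : Finset F.V) :
    Fintype.card (F.cont e).V ≤ Fintype.card F.V :=
  Fintype.card_le_of_injective (fun r : (F.cont e).V => r.1) Subtype.val_injective

theorem mem_linearPreorders {σ : F.V → Fin q} : σ ∈ F.linearPreorders q ↔ F.IsLinearPreorder σ := by
  simp [linearPreorders]

end RootedForest

/-! ### The combinatorial formula. -/

namespace ForestClass

variable {K : Type v} [Field K] {D : Type u} [CommSemigroup D]
  (φ : (TreeClass D →₀ K) →ₗ[K] MonoidAlgebra K D)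

/-- A fibre of `σ` is a union of components of `F.part e`, and by `mem_iff` the edges of `F` inside
it all lie in `e`. So the components of the forest induced on the fibre are the components of
`F.part e` that `σ` sends to `i`. -/
theorem block_eq_bracket (F : DecForest D) {e : Finset F.V} {q : ℕ} {σ : (F.cont e).V → Fin q}
    (hσ : (F.cont e).IsLinearPreorder σ) (i : Fin q) :
    block φ F e σ i = bracket φ (mk (F.induce fun v => σ (F.contMap e v) = i)) := by
  classical
  set p : F.V → Prop := fun v => σ (F.contMap e v) = i with hp
  have hstep : ∀ x y, p x → p y → ((F.part e).parent x = some y ↔ F.parent x = some y) := by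
    intro x y hx hy
    refine RootedForest.part_parent_eq_some.trans (and_iff_right_of_imp fun h => ?_)
    exact (hσ.mem_iff h).2 (hx.trans hy.symm)
  have hreach : ∀ x y, (F.part e).Reach x y → (p x ↔ p y) := by
    intro x y h
    simp only [hp, F.contMap_eq_of_reach h]
  have hroot : ∀ x : (F.induce p).V,
      (F.induce p).parent x = none ↔ (F.part e).parent x.1 = none := by
    intro x
    rw [Option.eq_none_iff_forall_ne_some, Option.eq_none_iff_forall_ne_some]
    constructor
    · intro h y hy
      have hpy := (hreach _ _ (Relation.ReflTransGen.single hy)).1 x.2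
      exact h ⟨y, hpy⟩ (F.toRootedForest.induce_parent_eq_some.2 ((hstep _ _ x.2 hpy).1 hy))
    · intro h y hy
      exact h y.1 ((hstep _ _ x.2 y.2).2 (F.toRootedForest.induce_parent_eq_some.1 hy))
  have hmem : ∀ r : (F.part e).Component,
      r ∈ (Finset.univ.filter fun r : (F.part e).Component => σ r = i) → p r.1 := by
    intro r hr
    change σ (F.contMap e r.1) = i
    rw [F.contMap_coe]
    exact (Finset.mem_filter.1 hr).2
  have hfiber : ∀ v, p v → σ (F.contMap e v) = i := fun _ h => h
  clear_value p
  rw [block, bracketProd, bracket, aug, treeLift_mk]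
  refine congrArg (fun x : Unitization K (MonoidAlgebra K D) => x.snd) (Finset.prod_bij' (fun r _ => ⟨r.1.1, (hroot r.1).1 r.2⟩)
    (fun r hr => ⟨⟨r.1, hmem r hr⟩, (hroot _).2 r.2⟩) ?_ ?_ ?_ ?_ ?_).symm
  · intro r _
    refine Finset.mem_filter.2 ⟨Finset.mem_univ _, ?_⟩
    have h := hfiber _ r.1.2
    rwa [F.contMap_coe e ⟨r.1.1, (hroot r.1).1 r.2⟩] at h
  · intro r _
    exact Finset.mem_univ _
  · intro r _
    rfl
  · intro r _
    rfl
  · intro r _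
    congr 3
    refine Subtype.ext (DecForest.mk_induce_eq_of_embedding (F := F.induce p) (G := F.part e)
      Subtype.val ?_ ?_ ?_ ?_ ?_)
    · intro x y _ _ h
      exact Subtype.ext h
    · intro x hx
      refine Relation.ReflTransGen.lift Subtype.val (fun a b h => ?_) _ _ hx
      exact (hstep _ _ a.2 b.2).2 (F.toRootedForest.induce_parent_eq_some.1 h)
    · intro y hy
      have hpy := (hreach _ _ hy).2 r.1.2
      refine ⟨⟨y, hpy⟩, ?_, rfl⟩
      have key : ∀ y, (F.part e).Reach y r.1.1 → ∀ hpy : p y,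
          (F.induce p).Reach ⟨y, hpy⟩ r.1 := by
        intro y hy
        induction hy using Relation.ReflTransGen.head_induction_on with
        | refl => intro h; exact Relation.ReflTransGen.refl
        | @head a b hab _ ih =>
          intro ha
          have hb := (hreach _ _ (Relation.ReflTransGen.single hab)).1 ha
          exact Relation.ReflTransGen.head
            (F.toRootedForest.induce_parent_eq_some.2 ((hstep _ _ ha hb).1 hab)) (ih hb)
      exact key y hy hpy
    · intro x y _ _
      exact F.toRootedForest.induce_parent_eq_some.trans (hstep _ _ x.2 y.2).symm
    · intro x _
      rfl

/-- The word lists the values of `σ` from the largest down, while `fiberWord` lists levels from `0`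
up; hence the reversal. -/
theorem preorderWord_eq_fiberWord (F : DecForest D) {e : Finset F.V} {q : ℕ}
    {σ : (F.cont e).V → Fin q} (hσ : (F.cont e).IsLinearPreorder σ) :
    preorderWord φ F e σ = fiberWord φ F fun v => (σ (F.contMap e v)).rev := by
  rw [preorderWord, fiberWord]
  congr 2
  funext i
  rw [block_eq_bracket φ F hσ]
  congr 1
  exact F.mk_induce_congr fun v => by rw [Fin.rev_eq_iff]

theorem sum_linearPreorders (F : DecForest D) (q : ℕ) :
    ∑ e ∈ F.edges.powerset, ∑ σ ∈ (F.cont e).linearPreorders q, preorderWord φ F e σ =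
      layer φ q (mk F) := by
  classical
  rw [layer_mk, ← Finset.sum_filter_of_ne (p := fun τ => Function.Surjective τ)
    fun τ _ h => by_contra fun h' => h (fiberWord_eq_zero φ h'), Finset.sum_sigma']
  refine Finset.sum_bij (fun x _ v => (x.2 (F.contMap x.1 v)).rev) ?_ ?_ ?_ ?_
  · rintro ⟨e, σ⟩ h
    rw [Finset.mem_sigma, Finset.mem_powerset, RootedForest.mem_linearPreorders] at h
    rw [Finset.mem_filter, RootedForest.mem_monotoneMaps]
    refine ⟨fun a b hab => Fin.rev_le_rev.2 (h.2.le_of_parent hab), fun i => ?_⟩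
    obtain ⟨r, hr⟩ := h.2.1 i.rev
    refine ⟨r.1, ?_⟩
    dsimp only at hr ⊢
    rw [F.contMap_coe, hr, Fin.rev_rev]
  · rintro ⟨e, σ⟩ h ⟨e', σ'⟩ h' heq
    rw [Finset.mem_sigma, Finset.mem_powerset, RootedForest.mem_linearPreorders] at h h'
    dsimp only at heq h h'
    obtain rfl : e = e' := by
      rw [← h.2.eq_constEdges h.1, heq, h'.2.eq_constEdges h'.1]
    congr 1
    funext r
    have := congrFun heq r.1
    rw [F.contMap_coe] at this
    exact Fin.rev_injective this
  · intro τ hτ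
    rw [Finset.mem_filter, RootedForest.mem_monotoneMaps] at hτ
    refine ⟨⟨RootedForest.constEdges τ, fun r => (τ r.1).rev⟩, ?_, ?_⟩
    · rw [Finset.mem_sigma, Finset.mem_powerset, RootedForest.mem_linearPreorders]
      exact ⟨RootedForest.constEdges_subset τ,
        RootedForest.isLinearPreorder_constEdges hτ.1 hτ.2⟩
    · funext v
      dsimp only
      rw [Fin.rev_rev]
      exact (RootedForest.eq_of_part_constEdges_reach ((F.part _).reach_rootOf v)).symm
  · rintro ⟨e, σ⟩ h
    rw [Finset.mem_sigma, Finset.mem_powerset, RootedForest.mem_linearPreorders] at h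
    exact preorderWord_eq_fiberWord φ F h.2

theorem flagSum_mk (F : DecForest D) : flagSum φ (mk F) =
    ∑ e ∈ F.edges.powerset, ∑ q ∈ Finset.range (Fintype.card (F.cont e).V + 1),
      ∑ σ ∈ (F.cont e).linearPreorders q, preorderWord φ F e σ := by
  have : ∀ e ∈ F.edges.powerset, ∑ q ∈ Finset.range (Fintype.card (F.cont e).V + 1),
      ∑ σ ∈ (F.cont e).linearPreorders q, preorderWord φ F e σ =
      ∑ q ∈ Finset.range (Fintype.card F.V + 1),
      ∑ σ ∈ (F.cont e).linearPreorders q, preorderWord φ F e σ := by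
    intro e _
    refine Finset.sum_subset
      (Finset.range_subset_range.2 (Nat.succ_le_succ (F.card_cont_le e))) fun q _ hq => ?_
    rw [Finset.mem_range, not_lt] at hq
    rw [RootedForest.linearPreorders_eq_empty hq, Finset.sum_empty]
  rw [Finset.sum_congr rfl this, Finset.sum_comm]
  exact Finset.sum_congr rfl fun q _ => (sum_linearPreorders φ F q).symm

end ForestClass

end
theorem mainTheorem10 {K : Type*} [Field K] [CharZero K] {D : Type*} [Nonempty D] [CommSemigroup D]
    (φ : (TreeClass D →₀ K) →ₗ[K] MonoidAlgebra K D) :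
    (∃! Φ : HCK K D →ₐc[K] Csh K D, Lifts φ Φ) ∧
    ∀ Φ : HCK K D →ₐc[K] Csh K D, Lifts φ Φ → ∀ T : DecForest D, T.IsTree →
      Φ (HCK.of K (ForestClass.mk T)) =
        ∑ e ∈ T.edges.powerset,
          ∑ q ∈ Finset.range (Fintype.card (T.cont e).V + 1),
            ∑ σ ∈ (T.cont e).linearPreorders q, preorderWord φ T e σ := by
  refine ⟨⟨ForestClass.flagHom φ, ForestClass.lifts_flagHom φ,
    fun Φ h => ForestClass.eq_flagHom_of_lifts φ h⟩, fun Φ h T _ => ?_⟩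
  rw [ForestClass.apply_of_of_lifts φ h, ForestClass.flagSum_mk]
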